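/- Let $d\ge 2$. A self-avoiding walk of length $n\ge 0$ is an injective map $\gamma:\{0,\dots,n\}\to\mathbb Z^d$ whose consecutive sites are nearest neighbours; write $|\gamma|=n$, and let $\mathrm{SAW}_n$ be the set of those with $\gamma_0=0$. Let $\mu_c=\lim_{n\to\infty}|\mathrm{SAW}_n|^{1/n}$ be the connective constant. Write $y(u)$ for the second coordinate of $u\in\mathbb Z^d$. A self-avoiding walk $\gamma$ of length $n$ is a bridge if $y(\gamma_0)<y(\gamma_k)$ for all $0<k\le n$ and $y(\gamma_k)\le y(\gamma_n)$ for all $0\le k\le n$. A bridge of length $n\ge 1$ is irreducible if there is no $k\in\{1,\dots,n-1\}$ for which $\gamma_0,\dots,\gamma_k$ and $\gamma_k,\dots,\gamma_n$ are both bridges. Let $\mathrm{iSAB}$ be the set of irreducible bridges of arbitrary length that start at $0$. Then the limit defining $\mu_c$ exists and lies in $(0,\infty)$, the formula $\mathsf P_{\mathrm{iSAB}}(\gamma)=\mu_c^{-|\gamma|}$ defines a probability measure on $\mathrm{iSAB}$, and under this measure the expected length is infinite: $$\mathbb E_{\mathrm{iSAB}}(|\gamma|)=\sum_{\gamma\in\mathrm{iSAB}}|\gamma|\,\mu_c^{-|\gamma|}=\infty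 .$$ -/

import Mathlib

open Filter Topology MeasureTheory
open scoped ENNReal

/-- Two sites of `ℤ^d` are nearest neighbours when their `ℓ¹` distance is one. -/
def LatticeAdj {d : ℕ} (u v : Fin d → ℤ) : Prop :=
  ∑ i, |u i - v i| = 1

/-- A self-avoiding walk of length `n`: an injective nearest-neighbour path with `n + 1` sites,
indexed by `{0, …, n}`. The starting point is arbitrary. -/
def IsSAW {d n : ℕ} (γ : Fin (n + 1) → Fin d → ℤ) : Prop :=
  (∀ i : Fin n, LatticeAdj (γ i.castSucc) (γ i.succ)) ∧ Function.Injective γ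

/-- The self-avoiding walks of length `n` in `ℤ^d` that start at the origin. -/
def SAW (d n : ℕ) : Set (Fin (n + 1) → Fin d → ℤ) :=
  {γ | IsSAW γ ∧ γ 0 = 0}

/-- The sequence `|SAW_n|^{1/n}`. -/
noncomputable def sawRoot (d n : ℕ) : ℝ :=
  ((SAW d n).ncard : ℝ) ^ (1 / (n : ℝ))

/-- The connective constant `μ_c = lim_n |SAW_n|^{1/n}`. -/
noncomputable def connectiveConstant (d : ℕ) : ℝ :=
  limUnder atTop (sawRoot d)

/-- The `y`-coordinate (second coordinate) of a site of `ℤ^d`, `d ≥ 2`. -/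
def yCoord {d : ℕ} (hd : 2 ≤ d) (u : Fin d → ℤ) : ℤ :=
  u ⟨1, hd⟩

/-- The subwalk `γ[i, j]` of the walk `γ` is a self-avoiding bridge: its first
site is the only one with minimal `y`-coordinate, and its last site attains the maximal
`y`-coordinate. (Nearest-neighbour steps and self-avoidance of the subwalk are inherited from `γ`,
which is required to be a self-avoiding walk.) -/
def IsBridgeOn {d n : ℕ} (hd : 2 ≤ d) (γ : Fin (n + 1) → Fin d → ℤ) (i j : Fin (n + 1)) : Prop :=
  IsSAW γ ∧ i ≤ j ∧
    (∀ k, i < k → k ≤ j → yCoord hd (γ i) < yCoord hd (γ k)) ∧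
    (∀ k, i ≤ k → k ≤ j → yCoord hd (γ k) ≤ yCoord hd (γ j))

/-- `γ` is a self-avoiding bridge. -/
def IsBridge {d n : ℕ} (hd : 2 ≤ d) (γ : Fin (n + 1) → Fin d → ℤ) : Prop :=
  IsBridgeOn hd γ 0 (Fin.last n)

/-- `γ i` is a renewal point of `γ`: both `γ[0, i]` and `γ[i, n]` are bridges. -/
def IsRenewal {d n : ℕ} (hd : 2 ≤ d) (γ : Fin (n + 1) → Fin d → ℤ) (i : Fin (n + 1)) : Prop :=
  IsBridgeOn hd γ 0 i ∧ IsBridgeOn hd γ i (Fin.last n)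

/-- An irreducible bridge: a bridge of length `n ≥ 1` without renewal points at the
indices `1, …, n - 1`. -/
def IsIrreducibleBridge {d n : ℕ} (hd : 2 ≤ d) (γ : Fin (n + 1) → Fin d → ℤ) : Prop :=
  1 ≤ n ∧ IsBridge hd γ ∧ ∀ k, 0 < k → k < Fin.last n → ¬ IsRenewal hd γ k

/-- The set of irreducible bridges of arbitrary length that start at the origin. -/
structure IrreducibleBridge {d : ℕ} (hd : 2 ≤ d) where
  /-- the number of edges -/
  length : ℕ
  /-- the sites -/
  walk : Fin (length + 1) → Fin d → ℤ
  start_eq : walk 0 = 0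
  irreducible : IsIrreducibleBridge hd walk

instance {d : ℕ} (hd : 2 ≤ d) : MeasurableSpace (IrreducibleBridge hd) := ⊤

/-- The measure on irreducible bridges that gives mass `μ_c^{-|γ|}` to each `γ`. -/
noncomputable def irreducibleBridgeLaw {d : ℕ} (hd : 2 ≤ d) : Measure (IrreducibleBridge hd) :=
  Measure.sum fun γ : IrreducibleBridge hd =>
    ENNReal.ofReal ((connectiveConstant d)⁻¹ ^ γ.length) • Measure.dirac γ

/-! A walk is handled as its list of steps from the origin and weighted by `μ_c⁻¹` per step.
Submultiplicativity gives the limit `μ_c` and shows that self-avoiding walks of each length have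
total weight at least 1. Bridges can be concatenated freely, so bridges of each length, in any
direction, have total weight at most 1.

Kesten's relation (`tsum_irredWeight`): every bridge is a unique concatenation of irreducible ones.
If the irreducible bridges had total weight above 1, words of `M` letters would outweigh the
linearly many available bridge lengths. If it were below 1, a geometric series would make the total
weight of bridges finite, hence, by a Hammersley–Welsh unfolding, also that of all self-avoiding
walks, which is false (`mass_dirBridges_eq_top`).

Infinite mean (`meanLength_eq_top`): suppose the mean is finite and concatenate independent
irreducible bridges in direction `j`. By the law of large numbers a word of `M` letters has length
`O(M)`, positive drift along `j` and, by reflection symmetry, transverse displacement `o(M)` along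
`i`. With probability bounded below it is also a bridge in the diagonal direction `coord i + coord
j` (`exists_le_mass_diag`). Letting `M` range over `[N, 2N)` gives a family of straight words of
weight at least a constant times `N`. Two such words, the second with coordinates `i` and `j`
exchanged, concatenate to a diagonal bridge of length `O(N)`, a class of weight only `O(N)`. Since
straight pieces hug different axes, the turning point is recoverable from the turned walk and a
label with only `o(N)` values (`mass_straightWords_sq_le`). So `N²` is at most a constant times `N ·
o(N)`, a contradiction. -/

namespace SelfAvoiding

/-! ### Sums of nonnegative weights over sets -/

/-- The total weight of a set. -/
noncomputable def mass {α : Type*} (u : α → ℝ≥0∞) (S : Set α) : ℝ≥0∞ := ∑' a : S, u a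

section Mass

variable {α β : Type*} {u : α → ℝ≥0∞} {v : β → ℝ≥0∞}

lemma mass_mono {S T : Set α} (h : S ⊆ T) : mass u S ≤ mass u T :=
  ENNReal.tsum_mono_subtype u h

lemma mass_union_le (S T : Set α) : mass u (S ∪ T) ≤ mass u S + mass u T :=
  ENNReal.tsum_union_le u S T

lemma mass_univ : mass u Set.univ = ∑' a, u a := by
  rw [mass, tsum_univ]

lemma mass_eq_tsum_indicator (S : Set α) : mass u S = ∑' a, S.indicator u a :=
  tsum_subtype S u

lemma mass_singleton (a : α) : mass u {a} = u a := by
  rw [mass, tsum_singleton a u]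

/-- A set covered by the image of another set has at most the mass of that set. -/
lemma mass_le_of_subset_image {S : Set β} {T : Set α} (φ : α → β) (h : S ⊆ φ '' T)
    (hu : ∀ t ∈ T, v (φ t) ≤ u t) : mass v S ≤ mass u T := by
  choose ψ hψ hφ using fun s : S => h s.2
  have hinj : Function.Injective (fun s : S => (⟨ψ s, hψ s⟩ : T)) := by
    intro a b hab
    have : ψ a = ψ b := congrArg Subtype.val hab
    exact Subtype.ext (by rw [← hφ a, ← hφ b, this])
  calc mass v S = ∑' s : S, v (φ (ψ s)) := by
        unfold mass; exact tsum_congr fun s => by rw [hφ]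
    _ ≤ ∑' s : S, u (ψ s) := ENNReal.tsum_le_tsum fun s => hu _ (hψ s)
    _ ≤ mass u T := ENNReal.tsum_comp_le_tsum_of_injective hinj (fun t : T => u t)

/-- An injective image of a set has at least the mass of that set. -/
lemma mass_le_of_injOn {S : Set β} {T : Set α} (φ : α → β) (hm : Set.MapsTo φ T S)
    (hi : Set.InjOn φ T) (hu : ∀ t ∈ T, u t ≤ v (φ t)) : mass u T ≤ mass v S := by
  calc mass u T ≤ ∑' t : T, v (φ t) := ENNReal.tsum_le_tsum fun t => hu _ t.2
    _ ≤ mass v S := ENNReal.tsum_comp_le_tsum_of_injective (f := fun t : T => (⟨φ t, hm t.2⟩ : S))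
        (fun a b hab => Subtype.ext (hi a.2 b.2 (congrArg Subtype.val hab))) (fun s : S => v s)

lemma mass_prod (S : Set α) (T : Set β) :
    mass (fun p : α × β => u p.1 * v p.2) (S ×ˢ T) = mass u S * mass v T := by
  unfold mass
  rw [← (Equiv.Set.prod S T).symm.tsum_eq, ENNReal.tsum_prod', ← ENNReal.tsum_mul_right]
  refine tsum_congr fun a => ?_
  rw [← ENNReal.tsum_mul_left]
  rfl

lemma mass_const_mul (c : ℝ≥0∞) (S : Set α) : mass (fun a => c * u a) S = c * mass u S :=
  ENNReal.tsum_mul_left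

/-- Decomposition of a set along the values of a function into a finite set. -/
lemma mass_fiber_sum {ι : Type*} [DecidableEq ι] (I : Finset ι) (ℓ : α → ι) (S : Set α) :
    mass u {a | a ∈ S ∧ ℓ a ∈ I} = ∑ n ∈ I, mass u {a | a ∈ S ∧ ℓ a = n} := by
  simp_rw [mass_eq_tsum_indicator]
  rw [← Summable.tsum_finsetSum fun _ _ => ENNReal.summable]
  refine tsum_congr fun a => ?_
  by_cases ha : a ∈ S
  · classical
    simp [Set.indicator_apply, ha]
  · simp [ha]

/-- Inclusion–exclusion written without subtraction, so that it needs no finiteness in `ℝ≥0∞`. -/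
lemma mass_inter_ge {S T U : Set α} (hS : S ⊆ U) (hT : T ⊆ U) :
    mass u S + mass u T ≤ mass u (S ∩ T) + mass u U := by
  simp_rw [mass_eq_tsum_indicator]
  rw [← ENNReal.tsum_add, ← ENNReal.tsum_add]
  refine ENNReal.tsum_le_tsum fun a => ?_
  by_cases h1 : a ∈ S <;> by_cases h2 : a ∈ T
  · simp [h1, h2, hS h1]
  · simp [h1, h2, hS h1]
  · simp [h1, h2, hT h2]
  · simp [h1, h2]

end Mass

/-! ### Walks as lists of steps -/

variable {d : ℕ}

/-- A unit vector of `ℤ^d`. -/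
def IsStep (s : Fin d → ℤ) : Prop := ∑ i, |s i| = 1

/-- The site reached after `k` steps by the walk from the origin with the given steps. -/
def pos (w : List (Fin d → ℤ)) (k : ℕ) : Fin d → ℤ := (w.take k).sum

/-- The walk from the origin with the given steps is self-avoiding. -/
def IsSelfAvoiding (w : List (Fin d → ℤ)) : Prop :=
  (∀ s ∈ w, IsStep s) ∧ ∀ i j, i < j → j ≤ w.length → pos w i ≠ pos w j

/-- The walk has its strict minimum in direction `g` at its start, and attains its maximum
at its end. -/
def IsDirBridge (g : (Fin d → ℤ) →+ ℤ) (w : List (Fin d → ℤ)) : Prop :=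
  (∀ k, 0 < k → k ≤ w.length → 0 < g (pos w k)) ∧ ∀ k, k ≤ w.length → g (pos w k) ≤ g w.sum

@[simp] lemma pos_zero (w : List (Fin d → ℤ)) : pos w 0 = 0 := by simp [pos]

@[simp] lemma pos_length (w : List (Fin d → ℤ)) : pos w w.length = w.sum := by simp [pos]

lemma pos_append_left {a b : List (Fin d → ℤ)} {k : ℕ} (h : k ≤ a.length) :
    pos (a ++ b) k = pos a k := by
  simp [pos, List.take_append_of_le_length h]

lemma pos_append_right (a b : List (Fin d → ℤ)) (k : ℕ) :
    pos (a ++ b) (a.length + k) = a.sum + pos b k := by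
  simp [pos, List.take_append, List.take_of_length_le]

lemma pos_take {w : List (Fin d → ℤ)} {m k : ℕ} (h : k ≤ m) : pos (w.take m) k = pos w k := by
  simp [pos, List.take_take, min_eq_left h]

lemma sum_drop (w : List (Fin d → ℤ)) (m : ℕ) : (w.drop m).sum = w.sum - pos w m := by
  rw [eq_sub_iff_add_eq', pos, List.sum_take_add_sum_drop]

lemma pos_drop {w : List (Fin d → ℤ)} {m : ℕ} (h : m ≤ w.length) (k : ℕ) :
    pos (w.drop m) k = pos w (m + k) - pos w m := by
  have := pos_append_right (w.take m) (w.drop m) k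
  rw [List.take_append_drop, List.length_take_of_le h] at this
  rw [this, pos, pos]; simp

lemma pos_map (σ : (Fin d → ℤ) →+ (Fin d → ℤ)) (w : List (Fin d → ℤ)) (k : ℕ) :
    pos (w.map σ) k = σ (pos w k) := by
  simp [pos, ← List.map_take, map_list_sum]

lemma sum_map_hom (σ : (Fin d → ℤ) →+ (Fin d → ℤ)) (w : List (Fin d → ℤ)) :
    (w.map σ).sum = σ w.sum := (map_list_sum σ w).symm

lemma isSelfAvoiding_nil : IsSelfAvoiding ([] : List (Fin d → ℤ)) :=
  ⟨by simp, by intro i j h1 h2; simp at h2; omega⟩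

lemma IsSelfAvoiding.take {w : List (Fin d → ℤ)} (h : IsSelfAvoiding w) (m : ℕ) :
    IsSelfAvoiding (w.take m) := by
  refine ⟨fun s hs => h.1 s (List.mem_of_mem_take hs), fun i j hij hj => ?_⟩
  rw [List.length_take, le_min_iff] at hj
  rw [pos_take (by omega), pos_take hj.1]
  exact h.2 i j hij hj.2

lemma IsSelfAvoiding.drop {w : List (Fin d → ℤ)} (h : IsSelfAvoiding w) (m : ℕ) :
    IsSelfAvoiding (w.drop m) := by
  refine ⟨fun s hs => h.1 s (List.mem_of_mem_drop hs), fun i j hij hj => ?_⟩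
  rw [List.length_drop] at hj
  rw [pos_drop (by omega), pos_drop (by omega), ne_eq, sub_left_inj]
  exact h.2 _ _ (by omega) (by omega)

lemma IsSelfAvoiding.map {w : List (Fin d → ℤ)} (h : IsSelfAvoiding w)
    {σ : (Fin d → ℤ) →+ (Fin d → ℤ)} (hσ : Function.Injective σ)
    (hs : ∀ s, IsStep s → IsStep (σ s)) : IsSelfAvoiding (w.map σ) := by
  refine ⟨fun s hs' => ?_, fun i j hij hj => ?_⟩
  · obtain ⟨t, ht, rfl⟩ := List.mem_map.1 hs'
    exact hs t (h.1 t ht)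
  · rw [pos_map, pos_map]
    exact fun he => h.2 i j hij (by simpa using hj) (hσ he)

lemma IsStep.neg {s : Fin d → ℤ} (h : IsStep s) : IsStep (-s) := by
  simpa [IsStep] using h

/-- The time-reversed walk. -/
def rev (w : List (Fin d → ℤ)) : List (Fin d → ℤ) := (w.map (fun s => -s)).reverse

@[simp] lemma length_rev (w : List (Fin d → ℤ)) : (rev w).length = w.length := by simp [rev]

@[simp] lemma rev_rev (w : List (Fin d → ℤ)) : rev (rev w) = w := by
  simp [rev]

@[simp] lemma sum_rev (w : List (Fin d → ℤ)) : (rev w).sum = -w.sum := by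
  induction w with
  | nil => simp [rev]
  | cons a w ih =>
    simp only [rev, List.map_cons, List.reverse_cons, List.sum_append, List.sum_cons,
      List.sum_nil, add_zero] at ih ⊢
    rw [ih]; abel

lemma pos_rev (w : List (Fin d → ℤ)) (k : ℕ) :
    pos (rev w) k = pos w (w.length - k) - w.sum := by
  have h1 : (rev w).take k = rev (w.drop (w.length - k)) := by
    simp [rev, List.take_reverse]
  rw [pos, h1, sum_rev, sum_drop]; abel

lemma IsSelfAvoiding.rev {w : List (Fin d → ℤ)} (h : IsSelfAvoiding w) :
    IsSelfAvoiding (rev w) := by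
  refine ⟨fun s hs => ?_, fun i j hij hj => ?_⟩
  · simp only [SelfAvoiding.rev, List.mem_reverse, List.mem_map] at hs
    obtain ⟨t, ht, rfl⟩ := hs
    exact (h.1 t ht).neg
  · rw [length_rev] at hj
    rw [pos_rev, pos_rev, ne_eq, sub_left_inj]
    exact fun he => h.2 _ _ (by omega) (by omega) he.symm

/-- The level of `g` at the end of `a` separates the two pieces: `a` never exceeds it, and `b` lies
strictly above it after its start. -/
lemma isSelfAvoiding_append {g : (Fin d → ℤ) →+ ℤ} {a b : List (Fin d → ℤ)}
    (ha : IsSelfAvoiding a) (hb : IsSelfAvoiding b)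
    (ha' : ∀ k, k ≤ a.length → g (pos a k) ≤ g a.sum)
    (hb' : ∀ k, 0 < k → k ≤ b.length → 0 < g (pos b k)) : IsSelfAvoiding (a ++ b) := by
  refine ⟨fun s hs => ?_, fun i j hij hj => ?_⟩
  · rcases List.mem_append.1 hs with h | h
    exacts [ha.1 s h, hb.1 s h]
  rw [List.length_append] at hj
  rcases le_or_gt j a.length with h1 | h1
  · rw [pos_append_left (by omega), pos_append_left h1]
    exact ha.2 i j hij h1
  obtain ⟨j, rfl⟩ := Nat.exists_eq_add_of_lt h1
  rw [add_assoc, pos_append_right]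
  rcases le_or_gt i a.length with h2 | h2
  · rw [pos_append_left h2]
    intro he
    have h3 := ha' i h2
    have h4 := hb' (j + 1) (by omega) (by omega)
    rw [he, map_add] at h3
    omega
  · obtain ⟨i, rfl⟩ := Nat.exists_eq_add_of_lt h2
    rw [add_assoc, pos_append_right, ne_eq, add_right_inj]
    exact hb.2 _ _ (by omega) (by omega)

section DirBridge

variable {g : (Fin d → ℤ) →+ ℤ}

lemma isDirBridge_nil : IsDirBridge g ([] : List (Fin d → ℤ)) :=
  ⟨by intro k h1 h2; simp at h2; omega, by intro k h; simp [pos]⟩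

lemma IsDirBridge.sum_nonneg {w : List (Fin d → ℤ)} (h : IsDirBridge g w) : 0 ≤ g w.sum := by
  simpa using h.2 0 (Nat.zero_le _)

lemma IsDirBridge.sum_pos {w : List (Fin d → ℤ)} (h : IsDirBridge g w) (hw : w ≠ []) :
    0 < g w.sum := by
  simpa using h.1 w.length (List.length_pos_iff.2 hw) le_rfl

lemma IsDirBridge.append {a b : List (Fin d → ℤ)} (ha : IsDirBridge g a)
    (hb : IsDirBridge g b) : IsDirBridge g (a ++ b) := by
  refine ⟨fun k h0 hk => ?_, fun k hk => ?_⟩ <;> rw [List.length_append] at hk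
  · rcases le_or_gt k a.length with h1 | h1
    · rw [pos_append_left h1]; exact ha.1 k h0 h1
    · obtain ⟨j, rfl⟩ := Nat.exists_eq_add_of_lt h1
      rw [add_assoc, pos_append_right, map_add]
      exact add_pos_of_nonneg_of_pos ha.sum_nonneg (hb.1 _ (by omega) (by omega))
  · rw [List.sum_append, map_add]
    rcases le_or_gt k a.length with h1 | h1
    · rw [pos_append_left h1]
      exact le_add_of_le_of_nonneg (ha.2 k h1) hb.sum_nonneg
    · obtain ⟨j, rfl⟩ := Nat.exists_eq_add_of_lt h1
      rw [add_assoc, pos_append_right, map_add]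
      exact add_le_add_right (hb.2 _ (by omega)) _

lemma IsDirBridge.map {w : List (Fin d → ℤ)} (h : IsDirBridge g w)
    {σ : (Fin d → ℤ) →+ (Fin d → ℤ)} (hg : ∀ s, g (σ s) = g s) : IsDirBridge g (w.map σ) := by
  simpa [IsDirBridge, pos_map, sum_map_hom, hg] using h

end DirBridge

/-- The self-avoiding walks from the origin that are bridges in direction `g`. -/
def dirBridges (g : (Fin d → ℤ) →+ ℤ) : Set (List (Fin d → ℤ)) :=
  {w | IsSelfAvoiding w ∧ IsDirBridge g w}

lemma dirBridges_append {g : (Fin d → ℤ) →+ ℤ} {a b : List (Fin d → ℤ)} (ha : a ∈ dirBridges g)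
    (hb : b ∈ dirBridges g) : a ++ b ∈ dirBridges g :=
  ⟨isSelfAvoiding_append ha.1 hb.1 ha.2.2 hb.2.1, ha.2.append hb.2⟩

lemma nil_mem_dirBridges {g : (Fin d → ℤ) →+ ℤ} : ([] : List (Fin d → ℤ)) ∈ dirBridges g :=
  ⟨isSelfAvoiding_nil, isDirBridge_nil⟩

/-! ### Coordinates and symmetries -/

/-- The `i`-th coordinate. -/
def coord (i : Fin d) : (Fin d → ℤ) →+ ℤ := Pi.evalAddMonoidHom (fun _ => ℤ) i

@[simp] lemma coord_apply (i : Fin d) (v : Fin d → ℤ) : coord i v = v i := rfl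

/-- Reflection of the `i`-th coordinate. -/
def flip (i : Fin d) : (Fin d → ℤ) →+ (Fin d → ℤ) where
  toFun v := fun j => if j = i then -v j else v j
  map_zero' := by ext j; simp
  map_add' v w := by
    ext j
    by_cases h : j = i
    · simp [h]; ring
    · simp [h]

lemma flip_apply (i j : Fin d) (v : Fin d → ℤ) : flip i v j = if j = i then -v j else v j := rfl

@[simp] lemma flip_flip (i : Fin d) (v : Fin d → ℤ) : flip i (flip i v) = v := by
  ext j; by_cases h : j = i <;> simp [flip_apply, h]

lemma flip_injective (i : Fin d) : Function.Injective (flip i) :=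
  Function.LeftInverse.injective (flip_flip i)

lemma IsStep.flip {s : Fin d → ℤ} (h : IsStep s) (i : Fin d) : IsStep (flip i s) := by
  rw [IsStep, ← h]
  refine Finset.sum_congr rfl fun j _ => ?_
  by_cases hj : j = i <;> simp [flip_apply, hj]

/-- Exchange of two coordinates. -/
def swapCoord (i j : Fin d) : (Fin d → ℤ) →+ (Fin d → ℤ) where
  toFun v := fun k => v (Equiv.swap i j k)
  map_zero' := rfl
  map_add' _ _ := rfl

lemma swapCoord_apply (i j k : Fin d) (v : Fin d → ℤ) :
    swapCoord i j v k = v (Equiv.swap i j k) := rfl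

lemma swapCoord_swapCoord (i j : Fin d) (v : Fin d → ℤ) :
    swapCoord i j (swapCoord i j v) = v := by
  ext k; simp [swapCoord_apply]

lemma swapCoord_injective (i j : Fin d) : Function.Injective (swapCoord i j) :=
  Function.LeftInverse.injective (swapCoord_swapCoord i j)

lemma IsStep.swapCoord {s : Fin d → ℤ} (h : IsStep s) (i j : Fin d) :
    IsStep (swapCoord i j s) := by
  rw [IsStep, ← h]
  exact Equiv.sum_comp (Equiv.swap i j) (fun k => |s k|)

lemma isStep_single (i : Fin d) : IsStep (Pi.single i 1 : Fin d → ℤ) := by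
  rw [IsStep, Finset.sum_eq_single i]
  · simp
  · intro j _ hj; simp [hj]
  · simp

lemma abs_coord_pos_le {w : List (Fin d → ℤ)} (h : ∀ s ∈ w, IsStep s) (i : Fin d) (k : ℕ) :
    |pos w k i| ≤ k := by
  have key : ∀ v : List (Fin d → ℤ), (∀ s ∈ v, IsStep s) → |v.sum i| ≤ v.length := by
    intro v hv
    induction v with
    | nil => simp
    | cons a v ih =>
      have h1 : |a i| ≤ 1 := by
        rw [← hv a (by simp)]
        exact Finset.single_le_sum (f := fun i => |a i|) (fun _ _ => abs_nonneg _)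
          (Finset.mem_univ i)
      have h2 := ih fun s hs => hv s (by simp [hs])
      have h3 := abs_add_le (a i) (v.sum i)
      simp only [List.sum_cons, Pi.add_apply, List.length_cons]
      push_cast
      linarith
  refine (key _ fun s hs => h s (List.mem_of_mem_take hs)).trans ?_
  exact_mod_cast List.length_take_le _ _

/-- The sum of two distinct coordinates changes by at most one in each step. -/
lemma abs_coord_add_pos_le {w : List (Fin d → ℤ)} (h : ∀ s ∈ w, IsStep s) {i j : Fin d}
    (hij : i ≠ j) (k : ℕ) : |pos w k i + pos w k j| ≤ k := by
  have key : ∀ v : List (Fin d → ℤ), (∀ s ∈ v, IsStep s) → |v.sum i + v.sum j| ≤ v.length := by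
    intro v hv
    induction v with
    | nil => simp
    | cons a v ih =>
      have h1 : |a i| + |a j| ≤ 1 := by
        rw [← hv a (by simp), ← Finset.sum_pair (f := fun i => |a i|) hij]
        exact Finset.sum_le_sum_of_subset_of_nonneg (f := fun i => |a i|) (by simp)
          fun _ _ _ => abs_nonneg _
      have h2 := ih fun s hs => hv s (by simp [hs])
      have h3 := abs_add_le (a i) (a j)
      have h4 := abs_add_le (a i + a j) (v.sum i + v.sum j)
      have h5 : a i + a j + (v.sum i + v.sum j) = a i + v.sum i + (a j + v.sum j) := by ring
      rw [h5] at h4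
      simp only [List.sum_cons, Pi.add_apply, List.length_cons]
      push_cast
      linarith
  refine (key _ fun s hs => h s (List.mem_of_mem_take hs)).trans ?_
  exact_mod_cast List.length_take_le _ _

/-! ### Walks as maps and as lists of steps -/

lemma pos_succ {w : List (Fin d → ℤ)} {k : ℕ} (h : k < w.length) :
    pos w (k + 1) = pos w k + w[k] :=
  List.sum_take_succ w k h

/-- The list of steps of a path. -/
def stepsOf {n : ℕ} (γ : Fin (n + 1) → Fin d → ℤ) : List (Fin d → ℤ) :=
  List.ofFn fun i : Fin n => γ i.succ - γ i.castSucc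

@[simp] lemma length_stepsOf {n : ℕ} (γ : Fin (n + 1) → Fin d → ℤ) :
    (stepsOf γ).length = n := by simp [stepsOf]

lemma pos_stepsOf {n : ℕ} (γ : Fin (n + 1) → Fin d → ℤ) (k : Fin (n + 1)) :
    pos (stepsOf γ) k = γ k - γ 0 := by
  obtain ⟨k, hk⟩ := k
  induction k with
  | zero => simp
  | succ k ih =>
    have h := ih (by omega)
    simp only at h ⊢
    rw [pos_succ (by simpa using hk), h]
    simp only [stepsOf, List.getElem_ofFn, Fin.succ_mk, Fin.castSucc_mk]
    abel

lemma stepsOf_pos {n : ℕ} {w : List (Fin d → ℤ)} (hw : w.length = n) :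
    stepsOf (fun k : Fin (n + 1) => pos w k) = w := by
  refine List.ext_getElem (by simp [hw]) fun k h1 h2 => ?_
  simp [stepsOf, pos_succ h2]

lemma isSAW_iff {n : ℕ} (γ : Fin (n + 1) → Fin d → ℤ) :
    IsSAW γ ↔ IsSelfAvoiding (stepsOf γ) := by
  refine and_congr ?_ ?_
  · simp only [stepsOf, List.mem_ofFn', Set.mem_range, forall_exists_index,
      forall_apply_eq_imp_iff, IsStep, LatticeAdj, Pi.sub_apply]
    refine forall_congr' fun i => ?_
    simp_rw [abs_sub_comm (γ i.succ _)]
  · constructor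
    · intro h i j hij hj he
      rw [length_stepsOf] at hj
      have h1 := pos_stepsOf γ ⟨i, by omega⟩
      have h2 := pos_stepsOf γ ⟨j, by omega⟩
      simp only at h1 h2
      rw [h1, h2, sub_left_inj] at he
      have := congrArg Fin.val (h he)
      simp only at this
      omega
    · intro h i j he
      by_contra hne
      rcases lt_or_gt_of_ne hne with hlt | hlt
      · exact h i j hlt (by have := j.2; simp; omega) (by rw [pos_stepsOf, pos_stepsOf, he])
      · exact h j i hlt (by have := i.2; simp; omega) (by rw [pos_stepsOf, pos_stepsOf, he])

/-- The self-avoiding walks of length `n` from the origin. -/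
def sawLists (d n : ℕ) : Set (List (Fin d → ℤ)) := {w | IsSelfAvoiding w ∧ w.length = n}

lemma ncard_SAW (d n : ℕ) : (SAW d n).ncard = (sawLists d n).ncard := by
  refine Set.ncard_congr (fun γ _ => stepsOf γ) (fun γ h => ?_) (fun γ γ' h h' he => ?_)
    (fun w hw => ?_)
  · exact ⟨(isSAW_iff γ).1 h.1, length_stepsOf γ⟩
  · funext k
    have h1 := pos_stepsOf γ k
    have h2 := pos_stepsOf γ' k
    rw [h.2, sub_zero] at h1
    rw [h'.2, sub_zero] at h2
    rw [← h1, ← h2, he]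
  · refine ⟨fun k => pos w k, ⟨?_, ?_⟩, stepsOf_pos hw.2⟩
    · rw [isSAW_iff, stepsOf_pos hw.2]; exact hw.1
    · simp

lemma finite_isStep (d : ℕ) : {s : Fin d → ℤ | IsStep s}.Finite := by
  refine (Set.finite_Icc (-1 : Fin d → ℤ) 1).subset fun s hs => ?_
  have h : ∀ i, |s i| ≤ 1 := fun i => by
    rw [← (show ∑ i, |s i| = 1 from hs)]
    exact Finset.single_le_sum (f := fun i => |s i|) (fun _ _ => abs_nonneg _) (Finset.mem_univ i)
  exact ⟨fun i => (abs_le.1 (h i)).1, fun i => (abs_le.1 (h i)).2⟩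

lemma finite_lists {α : Type*} {T : Set α} (hT : T.Finite) (n : ℕ) :
    {w : List α | (∀ s ∈ w, s ∈ T) ∧ w.length = n}.Finite := by
  induction n with
  | zero => exact (Set.finite_singleton []).subset fun w hw => List.length_eq_zero_iff.1 hw.2
  | succ n ih =>
    refine (hT.image2 List.cons ih).subset fun w hw => ?_
    obtain ⟨h1, h2⟩ := hw
    cases w with
    | nil => simp at h2
    | cons a w =>
      exact ⟨a, h1 a (by simp), w, ⟨fun s hs => h1 s (by simp [hs]), by simpa using h2⟩, rfl⟩

lemma finite_sawLists (d n : ℕ) : (sawLists d n).Finite :=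
  (finite_lists (finite_isStep d) n).subset fun _ hw => ⟨hw.1.1, hw.2⟩

lemma isSelfAvoiding_single (i : Fin d) : IsSelfAvoiding [(Pi.single i 1 : Fin d → ℤ)] := by
  refine ⟨by simpa using isStep_single i, fun k j h1 h2 => ?_⟩
  have hk : k = 0 := by simp at h2; omega
  have hj : j = 1 := by simp at h2; omega
  subst hk hj
  intro he
  have := congrFun he i
  simp [pos] at this

lemma isDirBridge_single {i : Fin d} {g : (Fin d → ℤ) →+ ℤ} (h : 0 < g (Pi.single i 1)) :
    IsDirBridge g [(Pi.single i 1 : Fin d → ℤ)] := by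
  refine ⟨fun k h1 h2 => ?_, fun k h2 => ?_⟩
  · obtain rfl : k = 1 := by simp at h2; omega
    simpa [pos] using h
  · have : k = 0 ∨ k = 1 := by simp at h2; omega
    rcases this with rfl | rfl
    · simpa using h.le
    · simp [pos]

/-- The straight walk. -/
lemma replicate_mem_dirBridges {i : Fin d} {g : (Fin d → ℤ) →+ ℤ} (h : 0 < g (Pi.single i 1))
    (n : ℕ) : List.replicate n (Pi.single i 1 : Fin d → ℤ) ∈ dirBridges g := by
  induction n with
  | zero => exact nil_mem_dirBridges
  | succ n ih => exact dirBridges_append ⟨isSelfAvoiding_single i, isDirBridge_single h⟩ ih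

/-! ### The connective constant -/

lemma sawLists_nonempty (hd : 0 < d) (n : ℕ) : (sawLists d n).Nonempty :=
  ⟨_, (replicate_mem_dirBridges (i := ⟨0, hd⟩) (g := coord ⟨0, hd⟩) (by simp) n).1, by simp⟩

lemma ncard_sawLists_pos (hd : 0 < d) (n : ℕ) : 0 < (sawLists d n).ncard :=
  (Set.ncard_pos (finite_sawLists d n)).2 (sawLists_nonempty hd n)

lemma ncard_sawLists_add_le (d m n : ℕ) :
    (sawLists d (m + n)).ncard ≤ (sawLists d m).ncard * (sawLists d n).ncard := by
  rw [← Set.ncard_prod]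
  refine Set.ncard_le_ncard_of_injOn (fun w => (w.take m, w.drop m)) (fun w hw => ?_)
    (fun w _ w' _ he => ?_) ((finite_sawLists d m).prod (finite_sawLists d n))
  · exact ⟨⟨hw.1.take m, by simp [hw.2]⟩, ⟨hw.1.drop m, by simp [hw.2]⟩⟩
  · rw [Prod.mk.injEq] at he
    rw [← List.take_append_drop m w, he.1, he.2, List.take_append_drop]

/-- Fekete's lemma for the logarithm of the number of walks. The limit is also the infimum, whence
the lower bound on every count. -/
lemma exists_connective_limit (hd : 0 < d) : ∃ μ : ℝ, 0 < μ ∧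
    Tendsto (sawRoot d) atTop (𝓝 μ) ∧ ∀ n, μ ^ n ≤ (sawLists d n).ncard := by
  set u : ℕ → ℝ := fun n => Real.log (sawLists d n).ncard with hu
  have hc : ∀ n, (1 : ℝ) ≤ (sawLists d n).ncard := fun n => by
    exact_mod_cast ncard_sawLists_pos hd n
  have hc0 : ∀ n, (0 : ℝ) < (sawLists d n).ncard := fun n => lt_of_lt_of_le one_pos (hc n)
  have hsub : Subadditive u := fun m n => by
    rw [hu, ← Real.log_mul (hc0 m).ne' (hc0 n).ne']
    exact Real.log_le_log (hc0 _) (by exact_mod_cast ncard_sawLists_add_le d m n)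
  have hbdd : BddBelow (Set.range fun n => u n / n) :=
    ⟨0, by rintro _ ⟨n, rfl⟩; exact div_nonneg (Real.log_nonneg (hc n)) (Nat.cast_nonneg n)⟩
  refine ⟨Real.exp hsub.lim, Real.exp_pos _, ?_, fun n => ?_⟩
  · refine ((Real.continuous_exp.tendsto _).comp (hsub.tendsto_lim hbdd)).congr fun n => ?_
    rw [sawRoot, ncard_SAW, Real.rpow_def_of_pos (hc0 n), Function.comp, hu]
    congr 1
    ring
  · rcases Nat.eq_zero_or_pos n with rfl | hn
    · simpa using hc 0
    · have h1 := hsub.lim_le_div hbdd hn.ne'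
      rw [← Real.exp_nat_mul, ← Real.exp_log (hc0 n)]
      refine Real.exp_le_exp.2 ?_
      rw [le_div_iff₀ (by exact_mod_cast hn)] at h1
      rw [mul_comm]; exact h1

lemma tendsto_sawRoot (hd : 0 < d) : Tendsto (sawRoot d) atTop (𝓝 (connectiveConstant d)) := by
  obtain ⟨μ, _, h, _⟩ := exists_connective_limit hd
  rwa [connectiveConstant, h.limUnder_eq]

lemma connectiveConstant_pos (hd : 0 < d) : 0 < connectiveConstant d := by
  obtain ⟨μ, h0, h, _⟩ := exists_connective_limit hd
  rwa [connectiveConstant, h.limUnder_eq]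

lemma connectiveConstant_pow_le (hd : 0 < d) (n : ℕ) :
    connectiveConstant d ^ n ≤ (sawLists d n).ncard := by
  obtain ⟨μ, _, h, h1⟩ := exists_connective_limit hd
  rw [connectiveConstant, h.limUnder_eq]
  exact h1 n

/-! ### Supermultiplicativity and growth of bridges -/

/-- The bridges of length `n` in a given direction. -/
def dirBridgeLists (g : (Fin d → ℤ) →+ ℤ) (n : ℕ) : Set (List (Fin d → ℤ)) :=
  {w | w ∈ dirBridges g ∧ w.length = n}

lemma finite_dirBridgeLists (g : (Fin d → ℤ) →+ ℤ) (n : ℕ) : (dirBridgeLists g n).Finite :=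
  (finite_sawLists d n).subset fun _ hw => ⟨hw.1.1, hw.2⟩

lemma ncard_dirBridgeLists_mul_le (g : (Fin d → ℤ) →+ ℤ) (m n : ℕ) :
    (dirBridgeLists g m).ncard * (dirBridgeLists g n).ncard ≤ (dirBridgeLists g (m + n)).ncard := by
  rw [← Set.ncard_prod]
  refine Set.ncard_le_ncard_of_injOn (fun p => p.1 ++ p.2) (fun p hp => ?_)
    (fun p hp p' hp' he => ?_) (finite_dirBridgeLists g _)
  · exact ⟨dirBridges_append hp.1.1 hp.2.1, by simp [hp.1.2, hp.2.2]⟩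
  · have := List.append_inj he (hp.1.2.trans hp'.1.2.symm)
    exact Prod.ext this.1 this.2

lemma ncard_dirBridgeLists_pow_le (g : (Fin d → ℤ) →+ ℤ) (n k : ℕ) :
    (dirBridgeLists g n).ncard ^ k ≤ (sawLists d (k * n)).ncard := by
  have h : (dirBridgeLists g n).ncard ^ k ≤ (dirBridgeLists g (k * n)).ncard := by
    induction k with
    | zero =>
      rw [pow_zero, zero_mul]
      exact (Set.ncard_pos (finite_dirBridgeLists g 0)).2 ⟨[], nil_mem_dirBridges, rfl⟩
    | succ k ih =>
      rw [pow_succ, add_mul, one_mul]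
      exact (Nat.mul_le_mul_right _ ih).trans (ncard_dirBridgeLists_mul_le g _ _)
  exact h.trans (Set.ncard_le_ncard (fun _ hw => ⟨hw.1.1, hw.2⟩) (finite_sawLists d _))

/-- Bridges in any direction of length `n` number at most `μ_c ^ n`. -/
lemma ncard_dirBridgeLists_le (hd : 0 < d) (g : (Fin d → ℤ) →+ ℤ) (n : ℕ) :
    ((dirBridgeLists g n).ncard : ℝ) ≤ connectiveConstant d ^ n := by
  rcases Nat.eq_zero_or_pos n with rfl | hn
  · rw [pow_zero]
    have : dirBridgeLists g 0 ⊆ {[]} := fun w hw => List.length_eq_zero_iff.1 hw.2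
    have := Set.ncard_le_ncard this
    rw [Set.ncard_singleton] at this
    exact_mod_cast this
  set b : ℝ := ((dirBridgeLists g n).ncard : ℝ)
  have hb : 0 ≤ b := Nat.cast_nonneg _
  have hn' : (n : ℝ) ≠ 0 := by exact_mod_cast hn.ne'
  -- Concatenating `k` bridges of length `n` bounds `b ^ k` by the number of walks of length `k *
  -- n`; take roots along these multiples of `n`.
  have hlim : Tendsto (fun k : ℕ => sawRoot d (k * n)) atTop (𝓝 (connectiveConstant d)) :=
    (tendsto_sawRoot hd).comp (tendsto_id.atTop_mul_const' hn)
  have hle : b ^ (1 / (n : ℝ)) ≤ connectiveConstant d := by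
    refine ge_of_tendsto hlim ?_
    filter_upwards [eventually_gt_atTop 0] with k hk
    have hk' : (k : ℝ) ≠ 0 := by exact_mod_cast hk.ne'
    have h1 : b ^ (k : ℝ) ≤ (sawLists d (k * n)).ncard := by
      rw [Real.rpow_natCast, ← Nat.cast_pow, Nat.cast_le]
      exact ncard_dirBridgeLists_pow_le g n k
    rw [sawRoot, ncard_SAW]
    calc b ^ (1 / (n : ℝ)) = (b ^ (k : ℝ)) ^ (1 / ((k * n : ℕ) : ℝ)) := by
          rw [← Real.rpow_mul hb]; congr 1; push_cast; field_simp
      _ ≤ _ := Real.rpow_le_rpow (Real.rpow_nonneg hb _) h1 (by positivity)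
  calc b = (b ^ (1 / (n : ℝ))) ^ n := by
        rw [← Real.rpow_natCast, ← Real.rpow_mul hb, one_div_mul_cancel hn', Real.rpow_one]
    _ ≤ _ := pow_le_pow_left₀ (Real.rpow_nonneg hb _) hle n

/-! ### Critical weights -/

/-- The weight `μ_c ^ (-|w|)`. -/
noncomputable def critWeight (d : ℕ) : ℝ≥0∞ := ENNReal.ofReal (connectiveConstant d)⁻¹

lemma critWeight_ne_top : critWeight d ≠ ⊤ := ENNReal.ofReal_ne_top

lemma critWeight_pos (hd : 0 < d) : 0 < critWeight d :=
  ENNReal.ofReal_pos.2 (inv_pos.2 (connectiveConstant_pos hd))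

/-- The weight `μ_c ^ (-|w|)` of a walk. -/
noncomputable def walkWeight (w : List (Fin d → ℤ)) : ℝ≥0∞ := critWeight d ^ w.length

lemma walkWeight_append (a b : List (Fin d → ℤ)) :
    walkWeight (a ++ b) = walkWeight a * walkWeight b := by
  simp [walkWeight, pow_add]

lemma mass_walkWeight_length (hd : 0 < d) {S : Set (List (Fin d → ℤ))} {n : ℕ}
    (h : ∀ w ∈ S, w.length = n) (hS : S.Finite) :
    mass walkWeight S = ENNReal.ofReal (S.ncard * (connectiveConstant d)⁻¹ ^ n) := by
  have : mass walkWeight S = ∑' _ : S, critWeight d ^ n :=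
    tsum_congr fun w => by rw [walkWeight, h w w.2]
  rw [this, ENNReal.tsum_set_const, ENNReal.ofReal_mul (Nat.cast_nonneg _), critWeight,
    ENNReal.ofReal_pow (inv_pos.2 (connectiveConstant_pos hd)).le, ENNReal.ofReal_natCast,
    ← hS.cast_ncard_eq]
  simp

lemma one_le_mass_sawLists (hd : 0 < d) (n : ℕ) : 1 ≤ mass walkWeight (sawLists d n) := by
  rw [mass_walkWeight_length hd (fun _ h => h.2) (finite_sawLists d n), ENNReal.one_le_ofReal,
    inv_pow, ← div_eq_mul_inv, one_le_div (pow_pos (connectiveConstant_pos hd) n)]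
  exact connectiveConstant_pow_le hd n

lemma mass_dirBridgeLists_le_one (hd : 0 < d) (g : (Fin d → ℤ) →+ ℤ) (n : ℕ) :
    mass walkWeight (dirBridgeLists g n) ≤ 1 := by
  rw [mass_walkWeight_length hd (fun _ h => h.2) (finite_dirBridgeLists g n),
    ENNReal.ofReal_le_one, inv_pow, ← div_eq_mul_inv,
    div_le_one (pow_pos (connectiveConstant_pos hd) n)]
  exact ncard_dirBridgeLists_le hd g n

lemma mass_length_le (S : Set (List (Fin d → ℤ))) (K : ℕ) :
    mass walkWeight {w | w ∈ S ∧ w.length ≤ K} =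
      ∑ n ∈ Finset.range (K + 1), mass walkWeight {w | w ∈ S ∧ w.length = n} := by
  rw [← mass_fiber_sum]
  simp

/-- Bridges of length at most `K` have total weight at most `K + 1`. -/
lemma mass_dirBridges_length_le (hd : 0 < d) (g : (Fin d → ℤ) →+ ℤ) (K : ℕ) :
    mass walkWeight {w | w ∈ dirBridges g ∧ w.length ≤ K} ≤ K + 1 := by
  rw [mass_length_le]
  refine (Finset.sum_le_sum fun n _ => mass_dirBridgeLists_le_one hd g n).trans ?_
  simp

/-- Self-avoiding walks of length at most `K` have total weight at least `K + 1`. -/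
lemma le_mass_selfAvoiding_length_le (hd : 0 < d) (K : ℕ) :
    (K + 1 : ℝ≥0∞) ≤ mass walkWeight {w : List (Fin d → ℤ) | IsSelfAvoiding w ∧ w.length ≤ K} := by
  have := mass_length_le {w : List (Fin d → ℤ) | IsSelfAvoiding w} K
  simp only [Set.mem_ofPred_eq] at this
  rw [this]
  refine le_trans ?_ (Finset.sum_le_sum fun n _ => one_le_mass_sawLists hd n)
  simp

/-- A sum in `ℝ≥0∞` is the supremum of its finite partial sums, and `ℓ` is bounded on a finite set.
-/
lemma mass_le_of_forall_le {α : Type*} {u : α → ℝ≥0∞} {S : Set α} (ℓ : α → ℕ) {c : ℝ≥0∞}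
    (h : ∀ K, mass u {a | a ∈ S ∧ ℓ a ≤ K} ≤ c) : mass u S ≤ c := by
  classical
  rw [mass_eq_tsum_indicator, ENNReal.tsum_eq_iSup_sum]
  refine iSup_le fun s => le_trans ?_ (h (s.sup ℓ))
  rw [mass_eq_tsum_indicator]
  refine le_trans (Finset.sum_le_sum fun a ha => ?_) (ENNReal.sum_le_tsum s)
  have : ℓ a ≤ s.sup ℓ := Finset.le_sup ha
  simp [Set.indicator_apply, this]

/-! ### Finiteness of the susceptibility from that of the bridge generating function -/

/-- Walks that stay in an open half space after their start, with height at most `K`. -/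
def halfSpaceWalks (g : (Fin d → ℤ) →+ ℤ) (K : ℕ) : Set (List (Fin d → ℤ)) :=
  {w | IsSelfAvoiding w ∧ (∀ k, 0 < k → k ≤ w.length → 0 < g (pos w k)) ∧
    ∀ k, k ≤ w.length → g (pos w k) ≤ K}

/-- The last time at which a property of times holds. -/
lemma exists_last {P : ℕ → Prop} {n : ℕ} (h : ∃ k ≤ n, P k) :
    ∃ t ≤ n, P t ∧ ∀ k, t < k → k ≤ n → ¬ P k := by
  classical
  obtain ⟨k, hk, hP⟩ := h
  exact ⟨Nat.findGreatest P n, Nat.findGreatest_le n, Nat.findGreatest_spec hk hP,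
    fun j h1 h2 => Nat.findGreatest_is_greatest h1 h2⟩

/-- One unfolding step. A walk reaching height `K + 1` is cut at its last visit there: the initial
piece is a bridge of that height, and the rest, reflected, is a half-space walk of height at most
`K`. -/
lemma mass_halfSpaceWalks_succ_le (i : Fin d) (K : ℕ) :
    mass walkWeight (halfSpaceWalks (coord i) (K + 1)) ≤
      mass walkWeight (halfSpaceWalks (coord i) K) *
        (1 + mass walkWeight {w | w ∈ dirBridges (coord i) ∧ (coord i w.sum).toNat = K + 1}) := by
  set H := halfSpaceWalks (coord i) K
  set B := {w | w ∈ dirBridges (coord i) ∧ (coord i w.sum).toNat = K + 1}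
  have hsub : halfSpaceWalks (coord i) (K + 1) ⊆
      H ∪ (fun p : List (Fin d → ℤ) × List (Fin d → ℤ) => p.2 ++ p.1.map (flip i)) '' (H ×ˢ B) := by
    rintro w ⟨hw, hpos, hle⟩
    by_cases h : ∃ k ≤ w.length, coord i (pos w k) = K + 1
    · right
      obtain ⟨t, ht, hPt, hlast⟩ := exists_last h
      have ht0 : 0 < t := by
        rcases Nat.eq_zero_or_pos t with rfl | h0
        · simp at hPt; omega
        · exact h0
      have hsum : (w.take t).sum = pos w t := rfl
      refine ⟨((w.drop t).map (flip i), w.take t), ⟨⟨?_, ?_, ?_⟩, ⟨⟨hw.take t, ?_, ?_⟩, ?_⟩⟩, ?_⟩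
      · exact (hw.drop t).map (flip_injective i) fun s hs => hs.flip i
      · intro k h0 hk
        simp only [List.length_map, List.length_drop] at hk
        have h1 := hlast (t + k) (by omega) (by omega)
        have h2 := hle (t + k) (by omega)
        rw [pos_map, pos_drop ht]
        simp only [coord_apply, flip_apply, if_true, Pi.sub_apply] at hPt h1 h2 ⊢
        push_cast at h2
        omega
      · intro k hk
        simp only [List.length_map, List.length_drop] at hk
        have h2 := hpos (t + k) (by omega) (by omega)
        rw [pos_map, pos_drop ht]
        simp only [coord_apply, flip_apply, if_true, Pi.sub_apply] at hPt h2 ⊢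
        omega
      · intro k h0 hk
        rw [List.length_take_of_le ht] at hk
        rw [pos_take hk]
        exact hpos k h0 (by omega)
      · intro k hk
        rw [List.length_take_of_le ht] at hk
        rw [pos_take hk, hsum, hPt]
        exact_mod_cast hle k (by omega)
      · rw [hsum, hPt]; omega
      · simp [List.map_map, Function.comp_def]
    · left
      refine ⟨hw, hpos, fun k hk => ?_⟩
      have h1 := hle k hk
      have h2 : coord i (pos w k) ≠ K + 1 := fun he => h ⟨k, hk, he⟩
      push_cast at h1
      omega
  calc _ ≤ _ := mass_mono hsub
    _ ≤ _ := mass_union_le _ _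
    _ ≤ mass walkWeight H + mass walkWeight H * mass walkWeight B := by
        rw [← mass_prod]
        refine add_le_add_right (mass_le_of_subset_image _ subset_rfl fun p _ => ?_) _
        rw [walkWeight_append, mul_comm]
        simp [walkWeight]
    _ = _ := by rw [mul_add, mul_one]

lemma mass_halfSpaceWalks_zero (i : Fin d) :
    mass walkWeight (halfSpaceWalks (coord i) 0) ≤ 1 := by
  have : halfSpaceWalks (coord i) 0 ⊆ {[]} := by
    rintro w ⟨_, h1, h2⟩
    by_contra hne
    have hl : 0 < w.length := List.length_pos_iff.2 hne
    have := h1 _ hl le_rfl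
    have := h2 _ le_rfl
    push_cast at this
    omega
  refine (mass_mono this).trans ?_
  rw [mass_singleton]; simp [walkWeight]

/-- Iterating the unfolding bounds the mass by the product of the factors `1 + b k`, hence by the
exponential of `∑ b k`. That sum is at most the mass of all bridges, since bridges of different
heights are disjoint. -/
lemma exists_mass_halfSpaceWalks_le {i : Fin d}
    (hB : mass walkWeight (dirBridges (coord i)) ≠ ⊤) :
    ∃ C : ℝ≥0∞, C ≠ ⊤ ∧ ∀ K, mass walkWeight (halfSpaceWalks (coord i) K) ≤ C := by
  set b : ℕ → ℝ≥0∞ := fun k =>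
    mass walkWeight {w | w ∈ dirBridges (coord i) ∧ (coord i w.sum).toNat = k} with hb
  have hsum : ∀ K, ∑ k ∈ Finset.range K, b k ≤ mass walkWeight (dirBridges (coord i)) := by
    intro K
    rw [hb, ← mass_fiber_sum]
    exact mass_mono fun w hw => hw.1
  have hbt : ∀ k, b k ≠ ⊤ := fun k => ne_top_of_le_ne_top hB (mass_mono fun w hw => hw.1)
  have key : ∀ K, mass walkWeight (halfSpaceWalks (coord i) K) ≤
      ENNReal.ofReal (Real.exp (∑ k ∈ Finset.range (K + 1), (b k).toReal)) := by
    intro K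
    induction K with
    | zero =>
      refine (mass_halfSpaceWalks_zero i).trans ?_
      rw [ENNReal.one_le_ofReal]
      exact Real.one_le_exp (Finset.sum_nonneg fun _ _ => ENNReal.toReal_nonneg)
    | succ K ih =>
      refine (mass_halfSpaceWalks_succ_le i K).trans ?_
      rw [Finset.sum_range_succ, Real.exp_add, ENNReal.ofReal_mul (Real.exp_pos _).le]
      refine mul_le_mul' ih ?_
      change 1 + b (K + 1) ≤ _
      rw [← ENNReal.ofReal_toReal (hbt (K + 1)), ← ENNReal.ofReal_one,
        ← ENNReal.ofReal_add zero_le_one ENNReal.toReal_nonneg, ENNReal.toReal_ofReal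
        ENNReal.toReal_nonneg, add_comm]
      exact ENNReal.ofReal_le_ofReal (Real.add_one_le_exp _)
  refine ⟨ENNReal.ofReal (Real.exp (mass walkWeight (dirBridges (coord i))).toReal),
    ENNReal.ofReal_ne_top, fun K => (key K).trans (ENNReal.ofReal_le_ofReal
    (Real.exp_le_exp.2 ?_))⟩
  rw [← ENNReal.toReal_sum fun k _ => hbt k]
  exact ENNReal.toReal_mono hB (hsum _)

/-- Every self-avoiding walk splits at its last lowest site into two half-space walks. -/
lemma mass_selfAvoiding_le (i : Fin d) (n : ℕ) :
    critWeight d * mass walkWeight {w : List (Fin d → ℤ) | IsSelfAvoiding w ∧ w.length ≤ n} ≤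
      mass walkWeight (halfSpaceWalks (coord i) (n + 1)) *
        mass walkWeight (halfSpaceWalks (coord i) (n + 1)) := by
  set H := halfSpaceWalks (coord i) (n + 1)
  rw [← mass_prod, ← mass_const_mul]
  refine le_trans ?_ (mass_mono (S := {p | p ∈ H ×ˢ H ∧ p.1 ≠ []}) fun p hp => hp.1)
  refine mass_le_of_subset_image
    (fun p : List (Fin d → ℤ) × List (Fin d → ℤ) => rev p.1.tail ++ p.2) ?_ ?_
  · rintro w ⟨hw, hn⟩
    have hmin : ∃ k ≤ w.length, ∀ j ≤ w.length, coord i (pos w k) ≤ coord i (pos w j) := by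
      obtain ⟨k, hk, h⟩ := Finset.exists_min_image (Finset.range (w.length + 1))
        (fun k => coord i (pos w k)) ⟨0, by simp⟩
      exact ⟨k, by simpa [Nat.lt_succ_iff] using hk, fun j hj => h j (by simpa [Nat.lt_succ_iff])⟩
    obtain ⟨t, ht, hmin, hlast⟩ := exists_last hmin
    -- The reversed initial piece may revisit the lowest level, as `t` is the last minimum.
    -- Prepending the upward step `e` makes it a strict half-space walk; this extra step accounts
    -- for the factor `critWeight d` and for the height bound `n + 1`.
    set e : Fin d → ℤ := Pi.single i 1
    have ha : IsSelfAvoiding (rev (w.take t ++ [-e])) := by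
      refine (isSelfAvoiding_append (g := -coord i) (hw.take t) ?_ (fun k hk => ?_)
        fun k h0 hk => ?_).rev
      · exact (isSelfAvoiding_single i).rev
      · rw [List.length_take_of_le ht] at hk
        rw [pos_take hk]
        exact neg_le_neg (hmin k (by omega))
      · obtain rfl : k = 1 := by simp at hk; omega
        simp [pos, e]
    have hrev : rev (w.take t ++ [-e]) = e :: rev (w.take t) := by simp [rev]
    rw [hrev] at ha
    have hlen : (e :: rev (w.take t)).length = t + 1 := by simp [ht]
    have hbound : ∀ v : List (Fin d → ℤ), IsSelfAvoiding v → v.length ≤ n + 1 →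
        ∀ k, k ≤ v.length → coord i (pos v k) ≤ ((n + 1 : ℕ) : ℤ) := fun v hv hl k hk => by
      have := (abs_le.1 (abs_coord_pos_le hv.1 i k)).2
      rw [coord_apply]; omega
    refine ⟨(e :: rev (w.take t), w.drop t), ⟨⟨⟨ha, ?_, hbound _ ha (hlen.trans_le (by omega))⟩,
      ⟨hw.drop t, ?_, hbound _ (hw.drop t) (by simp; omega)⟩⟩, by simp⟩, by simp⟩
    · intro k h0 hk
      rw [hlen] at hk
      obtain ⟨k, rfl⟩ := Nat.exists_eq_succ_of_ne_zero h0.ne'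
      have h1 := pos_append_right [e] (rev (w.take t)) k
      rw [List.length_singleton, List.singleton_append, add_comm 1 k] at h1
      rw [h1, pos_rev, List.length_take_of_le ht, pos_take (by omega)]
      have h2 := hmin (t - k) (by omega)
      change _ < coord i ([e].sum + (pos w (t - k) - pos w t))
      rw [map_add, map_sub]
      have h3 : coord i [e].sum = 1 := by simp [e]
      omega
    · intro k h0 hk
      rw [List.length_drop] at hk
      rw [pos_drop ht, map_sub]
      have h1 := hlast (t + k) (by omega) (by omega)
      push Not at h1
      obtain ⟨j, hj, hlt⟩ := h1
      have := hmin j hj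
      omega
  · rintro ⟨a, b⟩ ⟨_, hne⟩
    rw [walkWeight_append, ← mul_assoc]
    refine mul_le_mul_left (le_of_eq ?_) _
    cases a with
    | nil => simp at hne
    | cons s a => simp [walkWeight, pow_succ, mul_comm]

/-- The bridge generating function is infinite at criticality. -/
lemma mass_dirBridges_eq_top (i : Fin d) : mass walkWeight (dirBridges (coord i)) = ⊤ := by
  by_contra hB
  have hd : 0 < d := i.pos
  obtain ⟨C, hC, hle⟩ := exists_mass_halfSpaceWalks_le hB
  have h : ∀ n : ℕ, critWeight d * n ≤ C * C := fun n =>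
    calc critWeight d * n ≤ critWeight d * (n + 1) := by gcongr; exact le_self_add
      _ ≤ _ := mul_le_mul_right (le_mass_selfAvoiding_length_le hd n) _
      _ ≤ _ := mass_selfAvoiding_le i n
      _ ≤ _ := mul_le_mul' (hle _) (hle _)
  have hlim : Tendsto (fun n : ℕ => critWeight d * n) atTop (𝓝 (critWeight d * ⊤)) :=
    ENNReal.Tendsto.const_mul ENNReal.tendsto_nat_nhds_top (Or.inl (by simp))
  have := le_of_tendsto' hlim h
  rw [ENNReal.mul_top (critWeight_pos hd).ne', top_le_iff] at this
  exact ENNReal.mul_ne_top hC hC this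

/-! ### Irreducible bridges and Kesten's relation -/

/-- A nonempty bridge that is not the concatenation of two nonempty bridges. -/
def IsIrredBridge (g : (Fin d → ℤ) →+ ℤ) (w : List (Fin d → ℤ)) : Prop :=
  w ≠ [] ∧ w ∈ dirBridges g ∧
    ∀ k, 0 < k → k < w.length → ¬ (IsDirBridge g (w.take k) ∧ IsDirBridge g (w.drop k))

/-- The irreducible bridges in direction `g`. -/
@[ext] structure Irred (g : (Fin d → ℤ) →+ ℤ) where
  /-- the steps of the bridge -/
  steps : List (Fin d → ℤ)
  isIrredBridge : IsIrredBridge g steps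

variable {g : (Fin d → ℤ) →+ ℤ}

lemma Irred.steps_injective : Function.Injective (Irred.steps (g := g)) :=
  fun _ _ => Irred.ext

lemma Irred.steps_ne_nil (a : Irred g) : a.steps ≠ [] := a.2.1

lemma Irred.mem_dirBridges (a : Irred g) : a.steps ∈ dirBridges g := a.2.2.1

instance : Countable (Irred g) := Irred.steps_injective.countable

/-- The concatenation of a sequence of irreducible bridges. -/
def concat (l : List (Irred g)) : List (Fin d → ℤ) := (l.map Irred.steps).flatten

@[simp] lemma concat_nil : concat ([] : List (Irred g)) = [] := rfl

@[simp] lemma concat_cons (a : Irred g) (l : List (Irred g)) :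
    concat (a :: l) = a.steps ++ concat l := rfl

@[simp] lemma concat_append (l m : List (Irred g)) : concat (l ++ m) = concat l ++ concat m := by
  simp [concat]

lemma concat_mem_dirBridges (l : List (Irred g)) : concat l ∈ dirBridges g := by
  induction l with
  | nil => exact nil_mem_dirBridges
  | cons a l ih => exact dirBridges_append a.mem_dirBridges ih

/-- Otherwise `a' = a ++ c` with `c` a nonempty prefix of `b`. Then `c` is strictly positive after
its start because `b` is a bridge, and maximal at its end because `a'` is one, so `a'` would split
into two bridges. -/
lemma not_length_lt_of_append_eq {a a' b b' : List (Fin d → ℤ)} (ha : IsIrredBridge g a)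
    (ha' : IsIrredBridge g a') (hb : b ∈ dirBridges g) (h : a ++ b = a' ++ b') :
    ¬ a.length < a'.length := by
  intro hlt
  rcases List.append_eq_append_iff.1 h with ⟨c, rfl, rfl⟩ | ⟨c, rfl, rfl⟩
  · refine ha'.2.2 a.length (List.length_pos_iff.2 ha.1) hlt ⟨?_, ?_⟩
    · simpa using ha.2.1.2
    · rw [List.drop_left]
      refine ⟨fun k h0 hk => ?_, fun k hk => ?_⟩
      · have := hb.2.1 k h0 (by simp; omega)
        rwa [pos_append_left hk] at this
      · have := ha'.2.1.2.2 (a.length + k) (by simp; omega)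
        rw [pos_append_right, List.sum_append, map_add, map_add] at this
        linarith
  · simp at hlt

/-- The decomposition of a bridge into irreducible bridges is unique. -/
lemma concat_injective : Function.Injective (concat (g := g)) := by
  intro l
  induction l with
  | nil =>
    intro l' h
    cases l' with
    | nil => rfl
    | cons a l' => simp [a.steps_ne_nil] at h
  | cons a l ih =>
    intro l' h
    cases l' with
    | nil => simp [a.steps_ne_nil] at h
    | cons a' l' =>
      rw [concat_cons, concat_cons] at h
      have h1 := not_length_lt_of_append_eq a.2 a'.2 (concat_mem_dirBridges l) h
      have h2 := not_length_lt_of_append_eq a'.2 a.2 (concat_mem_dirBridges l') h.symm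
      obtain ⟨h3, h4⟩ := List.append_inj h (le_antisymm (not_lt.1 h2) (not_lt.1 h1))
      rw [Irred.steps_injective h3, ih h4]

lemma exists_concat_eq {w : List (Fin d → ℤ)} (hw : w ∈ dirBridges g) :
    ∃ l : List (Irred g), concat l = w := by
  induction hn : w.length using Nat.strong_induction_on generalizing w with
  | _ n ih =>
  by_cases h0 : w = []
  · exact ⟨[], by simp [h0]⟩
  by_cases hirr : IsIrredBridge g w
  · exact ⟨[⟨w, hirr⟩], by simp⟩
  have : ∃ k, 0 < k ∧ k < w.length ∧ IsDirBridge g (w.take k) ∧ IsDirBridge g (w.drop k) := by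
    by_contra hc
    push Not at hc
    exact hirr ⟨h0, hw, fun k h1 h2 h3 => hc k h1 h2 h3.1 h3.2⟩
  obtain ⟨k, h1, h2, h3, h4⟩ := this
  obtain ⟨l, hl⟩ := ih (w.take k).length (by simp; omega) ⟨hw.1.take k, h3⟩ rfl
  obtain ⟨m, hm⟩ := ih (w.drop k).length (by simp; omega) ⟨hw.1.drop k, h4⟩ rfl
  exact ⟨l ++ m, by rw [concat_append, hl, hm, List.take_append_drop]⟩

/-- The weight of a sequence of irreducible bridges. -/
noncomputable def wordWeight (l : List (Irred g)) : ℝ≥0∞ := walkWeight (concat l)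

/-- The weight of an irreducible bridge. -/
noncomputable def irredWeight (a : Irred g) : ℝ≥0∞ := walkWeight a.steps

@[simp] lemma wordWeight_nil : wordWeight ([] : List (Irred g)) = 1 := by
  simp [wordWeight, walkWeight]

@[simp] lemma wordWeight_cons (a : Irred g) (l : List (Irred g)) :
    wordWeight (a :: l) = irredWeight a * wordWeight l := by
  rw [wordWeight, concat_cons, walkWeight_append]; rfl

@[simp] lemma wordWeight_append (l m : List (Irred g)) :
    wordWeight (l ++ m) = wordWeight l * wordWeight m := by
  rw [wordWeight, concat_append, walkWeight_append]; rfl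

lemma wordWeight_eq_prod (l : List (Irred g)) : wordWeight l = (l.map irredWeight).prod := by
  induction l with
  | nil => simp
  | cons a l ih => simp [ih]

lemma mass_words (A : Set (Irred g)) (M : ℕ) :
    mass wordWeight {l : List (Irred g) | l.length = M ∧ ∀ a ∈ l, a ∈ A} =
      mass irredWeight A ^ M := by
  induction M with
  | zero =>
    have : {l : List (Irred g) | l.length = 0 ∧ ∀ a ∈ l, a ∈ A} = {[]} := by
      ext l; cases l <;> simp
    rw [this, mass_singleton]; simp
  | succ M ih =>
    rw [pow_succ', ← ih, ← mass_prod]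
    apply le_antisymm
    · refine mass_le_of_subset_image (fun p : Irred g × List (Irred g) => p.1 :: p.2) ?_
        fun p _ => by simp
      rintro l ⟨h1, h2⟩
      cases l with
      | nil => simp at h1
      | cons a l =>
        exact ⟨(a, l), ⟨h2 a (by simp), by simpa using h1, fun b hb => h2 b (by simp [hb])⟩, rfl⟩
    · refine mass_le_of_injOn (fun p : Irred g × List (Irred g) => p.1 :: p.2) ?_ ?_
        fun p _ => by simp
      · rintro ⟨a, l⟩ ⟨h1, h2, h3⟩
        refine ⟨by simpa using h2, fun b hb => ?_⟩
        rcases List.mem_cons.1 hb with rfl | hb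
        exacts [h1, h3 b hb]
      · rintro ⟨a, l⟩ _ ⟨b, m⟩ _ h
        simpa using h

lemma mass_words_univ (M : ℕ) :
    mass wordWeight {l : List (Irred g) | l.length = M} = (∑' a : Irred g, irredWeight a) ^ M := by
  have := mass_words (g := g) Set.univ M
  simpa [mass_univ] using this

/-- Exponential growth would beat the linear bound; the case `M = 1` already excludes `x = ⊤`. -/
lemma le_one_of_pow_le {x : ℝ≥0∞} {K : ℕ} (h : ∀ M : ℕ, x ^ M ≤ (M * K : ℕ) + 1) : x ≤ 1 := by
  by_contra hx
  push Not at hx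
  have hxt : x ≠ ⊤ := by
    refine ne_top_of_le_ne_top ?_ (by simpa using h 1)
    exact ENNReal.add_ne_top.2 ⟨ENNReal.natCast_ne_top K, ENNReal.one_ne_top⟩
  have hr : 1 < x.toReal := by
    rwa [← ENNReal.toReal_one, ENNReal.toReal_lt_toReal ENNReal.one_ne_top hxt]
  have h' : ∀ M : ℕ, x.toReal ^ M ≤ M * K + 1 := fun M => by
    have := ENNReal.toReal_mono
      (ENNReal.add_ne_top.2 ⟨ENNReal.natCast_ne_top _, ENNReal.one_ne_top⟩) (h M)
    rw [ENNReal.toReal_pow, ENNReal.toReal_add (ENNReal.natCast_ne_top _) ENNReal.one_ne_top,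
      ENNReal.toReal_natCast] at this
    simpa using this
  have h1 := (tendsto_pow_const_div_const_pow_of_one_lt 1 hr).mul_const (K : ℝ)
  have h2 := tendsto_pow_const_div_const_pow_of_one_lt 0 hr
  have h3 := h1.add h2
  rw [zero_mul, zero_add] at h3
  have h4 := ge_of_tendsto' h3 (b := 1) fun M => by
    rw [div_mul_eq_mul_div, ← add_div, one_le_div (pow_pos (by linarith) M)]
    simpa using h' M
  linarith

/-- Restricted to letters of length at most `K`, words of `M` letters inject into bridges of length
at most `M * K`, whose mass is at most `M * K + 1`. The truncation is then removed. -/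
lemma tsum_irredWeight_le_one (hd : 0 < d) (g : (Fin d → ℤ) →+ ℤ) :
    ∑' a : Irred g, irredWeight a ≤ 1 := by
  rw [← mass_univ]
  refine mass_le_of_forall_le (fun a => a.steps.length) fun K => ?_
  refine le_one_of_pow_le (K := K) fun M => ?_
  rw [← mass_words]
  refine le_trans ?_ (mass_dirBridges_length_le hd g (M * K))
  refine mass_le_of_injOn concat ?_ concat_injective.injOn fun l _ => le_rfl
  rintro l ⟨rfl, h⟩
  refine ⟨concat_mem_dirBridges l, ?_⟩
  rw [concat, List.length_flatten]
  refine (List.sum_le_card_nsmul _ K fun n hn => ?_).trans (by simp)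
  simp only [List.map_map, List.mem_map, Function.comp] at hn
  obtain ⟨a, ha, rfl⟩ := hn
  exact (h a ha).2

/-- Kesten's relation. -/
lemma tsum_irredWeight (i : Fin d) : ∑' a : Irred (coord i), irredWeight a = 1 := by
  refine le_antisymm (tsum_irredWeight_le_one i.pos _) ?_
  by_contra hlt
  push Not at hlt
  set I := ∑' a : Irred (coord i), irredWeight a with hI
  -- Factorising bridges into irreducible ones bounds their mass by the geometric series in `I`,
  -- which is finite if `I < 1`.
  have h1 : mass walkWeight (dirBridges (coord i)) ≤ (1 - I)⁻¹ := by
    calc mass walkWeight (dirBridges (coord i))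
        ≤ mass wordWeight (⋃ M, {l : List (Irred (coord i)) | l.length = M}) := by
          refine mass_le_of_subset_image concat (fun w hw => ?_) fun _ _ => le_rfl
          obtain ⟨l, hl⟩ := exists_concat_eq hw
          exact ⟨l, by simp, hl⟩
      _ ≤ ∑' M, mass wordWeight {l : List (Irred (coord i)) | l.length = M} :=
          ENNReal.tsum_iUnion_le_tsum _ _
      _ = (1 - I)⁻¹ := by simp_rw [mass_words_univ, ← hI, ENNReal.tsum_geometric]
  rw [mass_dirBridges_eq_top, top_le_iff, ENNReal.inv_eq_top, tsub_eq_zero_iff_le] at h1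
  exact absurd hlt (not_lt.2 h1)

/-! ### Independent sequences of irreducible bridges -/

lemma concat_sum_map {g : (Fin d → ℤ) →+ ℤ} (h : (Fin d → ℤ) →+ ℤ) (l : List (Irred g)) :
    h (concat l).sum = (l.map fun a => h a.steps.sum).sum := by
  induction l with
  | nil => simp
  | cons a l ih => simp [ih]

lemma length_concat {g : (Fin d → ℤ) →+ ℤ} (l : List (Irred g)) :
    (concat l).length = (l.map fun a => a.steps.length).sum := by
  induction l with
  | nil => simp
  | cons a l ih => simp [ih]

lemma sum_map_range {α β : Type*} [AddCommMonoid β] (ω : ℕ → α) (f : α → β) (n : ℕ) :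
    (((List.range n).map ω).map f).sum = ∑ i ∈ Finset.range n, f (ω i) := by
  induction n with
  | zero => simp
  | succ n ih => rw [List.range_succ, List.map_append, List.map_append, List.sum_append, ih,
      Finset.sum_range_succ]; simp

lemma map_range_eq_append {α : Type*} {ω : ℕ → α} {M : ℕ} {p s : List α} {a : α}
    (h : (List.range M).map ω = p ++ a :: s) :
    p.length < M ∧ p = (List.range p.length).map ω ∧ a = ω p.length := by
  have hl := congrArg List.length h
  simp only [List.length_map, List.length_range, List.length_append, List.length_cons] at hl
  refine ⟨by omega, ?_, ?_⟩
  · have := congrArg (List.take p.length) h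
    rw [List.take_left, ← List.map_take, List.take_range, min_eq_left (by omega)] at this
    exact this.symm
  · have := congrArg (fun l => l[p.length]?) h
    simp [show p.length < M by omega] at this
    exact this.symm

instance {g : (Fin d → ℤ) →+ ℤ} : MeasurableSpace (Irred g) := ⊤

instance {g : (Fin d → ℤ) →+ ℤ} : DiscreteMeasurableSpace (Irred g) := ⟨fun _ => trivial⟩

/-- The law `γ ↦ μ_c ^ (-|γ|)` on irreducible bridges. -/
noncomputable def irredPMF (j : Fin d) : PMF (Irred (coord j)) :=
  ⟨irredWeight, ENNReal.summable.hasSum_iff.2 (tsum_irredWeight j)⟩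

/-- The law of an independent sequence of irreducible bridges. -/
noncomputable def seqLaw (j : Fin d) : Measure (ℕ → Irred (coord j)) :=
  Measure.infinitePi fun _ => (irredPMF j).toMeasure

instance (j : Fin d) : IsProbabilityMeasure (seqLaw j) := by
  unfold seqLaw; infer_instance

/-- Dictionary between the two viewpoints: the mass of a set of `M`-letter words is the probability
that the first `M` terms of the random sequence form such a word. -/
lemma seqLaw_map_range (j : Fin d) (M : ℕ) (Q : Set (List (Irred (coord j)))) :
    seqLaw j {ω | (List.range M).map ω ∈ Q} =
      mass wordWeight {l | l.length = M ∧ l ∈ Q} := by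
  set T := {l : List (Irred (coord j)) | l.length = M ∧ l ∈ Q}
  have hpre : {ω : ℕ → Irred (coord j) | (List.range M).map ω ∈ Q} =
      (fun ω => (List.range M).map ω) ⁻¹' T := by
    ext ω; simp [T]
  have hcyl : ∀ l ∈ T, (fun ω : ℕ → Irred (coord j) => (List.range M).map ω) ⁻¹' {l} =
      Set.pi (Finset.range M : Finset ℕ) (fun i => {a | l[i]? = some a}) := by
    intro l hl
    ext ω
    simp only [Set.mem_preimage, Set.mem_singleton_iff, Set.mem_pi, Finset.coe_range,
      Set.mem_Iio, Set.mem_ofPred_eq]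
    constructor
    · rintro rfl i hi
      simp [hi]
    · intro h
      refine List.ext_getElem? fun i => ?_
      by_cases hi : i < M
      · rw [h i hi]; simp [hi]
      · rw [List.getElem?_eq_none (by simp; omega), List.getElem?_eq_none (by rw [hl.1]; omega)]
  rw [hpre, ← tsum_measure_preimage_singleton T.to_countable]
  · refine tsum_congr fun ⟨l, hl⟩ => ?_
    rw [hcyl l hl, seqLaw, Measure.infinitePi_pi _ fun _ _ => MeasurableSet.of_discrete,
      wordWeight_eq_prod, Finset.prod_range]
    have hll : l.length = M := hl.1
    subst hll
    have hprod : (l.map irredWeight).prod = ∏ i : Fin l.length, irredWeight l[i] := by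
      conv_lhs => rw [← List.ofFn_getElem (xs := l), List.map_ofFn, List.prod_ofFn]
      rfl
    refine Eq.trans ?_ hprod.symm
    refine Finset.prod_congr rfl fun i _ => ?_
    have : {a | l[(i : ℕ)]? = some a} = {l[i]} := by
      ext a; simp [eq_comm]
    rw [this, PMF.toMeasure_apply_singleton _ _ (MeasurableSet.singleton _)]
    rfl
  · intro l hl
    rw [hcyl l hl]
    exact MeasurableSet.pi (Finset.countable_toSet _) fun _ _ => MeasurableSet.of_discrete

/-- The strong law of large numbers along a sequence of irreducible bridges. -/
lemma seqLaw_strong_law {j : Fin d} (h : Irred (coord j) → ℝ)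
    (hi : Integrable h (irredPMF j).toMeasure) :
    ∀ᵐ ω ∂seqLaw j, Tendsto (fun n : ℕ => (∑ i ∈ Finset.range n, h (ω i)) / n) atTop
      (𝓝 (∫ a, h a ∂(irredPMF j).toMeasure)) := by
  have hmp : ∀ i, MeasurePreserving (fun ω : ℕ → Irred (coord j) => ω i) (seqLaw j)
      (irredPMF j).toMeasure := fun i => measurePreserving_eval_infinitePi _ i
  have hmeas : Measurable h := measurable_of_countable h
  have key := ProbabilityTheory.strong_law_ae_real (μ := seqLaw j) (fun i ω => h (ω i))
    ((hmp 0).integrable_comp_of_integrable hi) ?_ ?_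
  · have h0 : ∫ ω, h (ω 0) ∂seqLaw j = ∫ a, h a ∂(irredPMF j).toMeasure := by
      rw [← (hmp 0).map_eq, integral_map (hmp 0).measurable.aemeasurable
        hmeas.aestronglyMeasurable]
    rwa [h0] at key
  · intro a b hab
    exact (ProbabilityTheory.iIndepFun_infinitePi (P := fun _ => (irredPMF j).toMeasure)
      (X := fun _ => h) fun _ => hmeas).indepFun hab
  · intro i
    refine ⟨(hmeas.comp (hmp i).measurable).aemeasurable,
      (hmeas.comp (hmp 0).measurable).aemeasurable, ?_⟩
    change Measure.map (h ∘ fun ω : ℕ → Irred (coord j) => ω i) _ = Measure.map (h ∘ fun ω : ℕ → Irred (coord j) => ω 0) _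
    rw [← Measure.map_map hmeas (hmp i).measurable, ← Measure.map_map hmeas (hmp 0).measurable,
      (hmp i).map_eq, (hmp 0).map_eq]

/-- Applied to partial sums of lengths, it shows that under a finite mean a single letter has length
`o(n)`. -/
lemma tendsto_increment_div {s : ℕ → ℝ} {c : ℝ}
    (h : Tendsto (fun n : ℕ => s n / n) atTop (𝓝 c)) :
    Tendsto (fun n : ℕ => (s (n + 1) - s n) / n) atTop (𝓝 0) := by
  have h1 := ((h.comp (tendsto_add_atTop_nat 1)).mul
    ((tendsto_one_div_atTop_nhds_zero_nat (𝕜 := ℝ)).const_add 1)).sub h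
  rw [add_zero, mul_one, sub_self] at h1
  refine h1.congr' ?_
  filter_upwards [eventually_gt_atTop 0] with n hn
  have hn' : (n : ℝ) ≠ 0 := by exact_mod_cast hn.ne'
  have hn1 : (n : ℝ) + 1 ≠ 0 := by positivity
  simp only [Function.comp]
  push_cast
  field_simp

/-- A process with positive drift is bounded below, uniformly with high probability. -/
lemma exists_measure_le_of_drift {j : Fin d} {T : ℕ → (ℕ → Irred (coord j)) → ℝ}
    (hT : ∀ r, Measurable (T r)) {c : ℝ} (hc : 0 < c)
    (h : ∀ᵐ ω ∂seqLaw j, Tendsto (fun r : ℕ => T r ω / r) atTop (𝓝 c)) {δ : ℝ≥0∞} (hδ : 0 < δ) :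
    ∃ m : ℕ, seqLaw j {ω | ∃ r, T r ω ≤ -m} ≤ δ := by
  set B : ℕ → Set (ℕ → Irred (coord j)) := fun m => {ω | ∃ r, T r ω ≤ -m}
  have hB : ∀ m, MeasurableSet (B m) := fun m => by
    have : B m = ⋃ r, {ω | T r ω ≤ -m} := by ext; simp [B]
    rw [this]
    exact MeasurableSet.iUnion fun r => measurableSet_le (hT r) measurable_const
  have hanti : Antitone B := fun m n hmn ω ⟨r, hr⟩ =>
    ⟨r, hr.trans (neg_le_neg (by exact_mod_cast hmn))⟩
  -- Almost surely `T r ω` tends to infinity, hence is bounded below; continuity from above then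
  -- makes some `B m` small.
  have hzero : seqLaw j (⋂ m, B m) = 0 := by
    rw [measure_eq_zero_iff_ae_notMem]
    filter_upwards [h] with ω hω hmem
    have htop : Tendsto (fun r => T r ω) atTop atTop := by
      refine (hω.pos_mul_atTop hc tendsto_natCast_atTop_atTop).congr' ?_
      filter_upwards [eventually_gt_atTop 0] with r hr
      have : (r : ℝ) ≠ 0 := by exact_mod_cast hr.ne'
      field_simp
    obtain ⟨b, hb⟩ := bddBelow_range_of_tendsto_atTop_atTop htop
    obtain ⟨m, hm⟩ := exists_nat_gt (-b)
    obtain ⟨r, hr⟩ := Set.mem_iInter.1 hmem m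
    have := hb ⟨r, rfl⟩
    simp only at this
    linarith
  have hlim := tendsto_measure_iInter_atTop (μ := seqLaw j)
    (fun m => (hB m).nullMeasurableSet) hanti ⟨0, measure_ne_top _ _⟩
  rw [hzero] at hlim
  exact ((hlim.eventually_lt_const hδ).exists).imp fun m hm => hm.le

/-- Transfers a bound holding for all times of the infinite sequence to words of every length `M`,
with the same `m` and `δ`. -/
lemma one_sub_le_mass_of_drift {j : Fin d} {T : ℕ → (ℕ → Irred (coord j)) → ℝ} {m : ℕ}
    {δ : ℝ≥0∞} (h : seqLaw j {ω | ∃ r, T r ω ≤ -m} ≤ δ) {M : ℕ}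
    {Q : Set (List (Irred (coord j)))}
    (hQ : ∀ ω, (∀ r, -(m : ℝ) < T r ω) → (List.range M).map ω ∈ Q) :
    1 ≤ mass wordWeight {l | l.length = M ∧ l ∈ Q} + δ := by
  rw [← seqLaw_map_range, ← measure_univ (μ := seqLaw j)]
  refine le_trans ?_ (add_le_add_right h _)
  refine le_trans (measure_mono fun ω _ => ?_) (measure_union_le _ _)
  by_cases hω : ∃ r, T r ω ≤ -m
  · exact Or.inr hω
  · push Not at hω
    exact Or.inl (hQ ω hω)

/-! ### Consequences of a finite mean length -/

/-- The mean length of an irreducible bridge. -/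
noncomputable def meanLength (j : Fin d) : ℝ≥0∞ :=
  ∑' a : Irred (coord j), irredWeight a * a.steps.length

section FiniteMean

variable {i j : Fin d}

lemma integrable_of_abs_le (hL : meanLength j ≠ ⊤) {h : Irred (coord j) → ℝ}
    (hh : ∀ a, |h a| ≤ a.steps.length) : Integrable h (irredPMF j).toMeasure := by
  have hlen : Integrable (fun a : Irred (coord j) => (a.steps.length : ℝ))
      (irredPMF j).toMeasure := by
    refine ⟨(measurable_of_countable _).aestronglyMeasurable, ?_⟩
    rw [HasFiniteIntegral, lintegral_countable']
    refine lt_of_le_of_lt (le_of_eq ?_) hL.lt_top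
    refine tsum_congr fun a => ?_
    rw [PMF.toMeasure_apply_singleton _ _ (MeasurableSet.singleton _), mul_comm]
    rw [Real.enorm_of_nonneg (Nat.cast_nonneg _), ENNReal.ofReal_natCast]
    rfl
  exact hlen.mono' (measurable_of_countable _).aestronglyMeasurable
    (Eventually.of_forall fun a => by simpa using hh a)

lemma abs_sum_coord_le (a : Irred (coord j)) (k : Fin d) :
    |((a.steps.sum k : ℤ) : ℝ)| ≤ a.steps.length := by
  have := abs_coord_pos_le a.mem_dirBridges.1.1 k a.steps.length
  rw [pos_length] at this
  exact_mod_cast this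

/-- Reflection of an irreducible bridge in a direction transverse to it. -/
def Irred.flip (hij : i ≠ j) (a : Irred (coord j)) : Irred (coord j) where
  steps := a.steps.map (SelfAvoiding.flip i)
  isIrredBridge := by
    have hg : ∀ s, coord j (SelfAvoiding.flip i s) = coord j s := fun s => by
      simp [flip_apply, hij.symm]
    have hb : ∀ w : List (Fin d → ℤ), IsDirBridge (coord j) (w.map (SelfAvoiding.flip i)) →
        IsDirBridge (coord j) w := fun w hw => by
      have := hw.map hg
      simpa [List.map_map, Function.comp_def] using this
    obtain ⟨h0, ⟨h1, h2⟩, h3⟩ := a.isIrredBridge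
    refine ⟨by simpa using h0, ⟨h1.map (flip_injective i) fun s hs => hs.flip i, h2.map hg⟩, ?_⟩
    intro k hk hk' h
    rw [List.length_map] at hk'
    rw [← List.map_take, ← List.map_drop] at h
    exact h3 k hk hk' ⟨hb _ h.1, hb _ h.2⟩

lemma Irred.flip_flip (hij : i ≠ j) (a : Irred (coord j)) : (a.flip hij).flip hij = a := by
  apply Irred.ext
  simp [Irred.flip, List.map_map, Function.comp_def]

/-- Reflecting coordinate `i` preserves length and the bridge property in direction `j`, but changes
the sign of the integrand. -/
lemma integral_transverse (hij : i ≠ j) (hL : meanLength j ≠ ⊤) :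
    ∫ a : Irred (coord j), ((a.steps.sum i : ℤ) : ℝ) ∂(irredPMF j).toMeasure = 0 := by
  rw [PMF.integral_eq_tsum _ _ (integrable_of_abs_le hL fun a => abs_sum_coord_le a i)]
  set e : Irred (coord j) ≃ Irred (coord j) :=
    ⟨Irred.flip hij, Irred.flip hij, Irred.flip_flip hij, Irred.flip_flip hij⟩
  set S := ∑' a : Irred (coord j), (irredPMF j a).toReal • ((a.steps.sum i : ℤ) : ℝ) with hS
  have h : S = -S := by
    rw [hS, ← tsum_neg]
    conv_lhs => rw [← e.tsum_eq]
    refine tsum_congr fun a => ?_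
    have h1 : irredPMF j (e a) = irredPMF j a := by
      change critWeight d ^ (a.steps.map (SelfAvoiding.flip i)).length = _
      rw [List.length_map]; rfl
    have h2 : (e a).steps.sum i = -a.steps.sum i := by
      change (a.steps.map (SelfAvoiding.flip i)).sum i = _
      rw [sum_map_hom]; simp [flip_apply]
    rw [h1, h2]; simp
  linarith

/-- A nonempty bridge gains a positive integer height, hence at least 1. -/
lemma one_le_integral_axial (hL : meanLength j ≠ ⊤) :
    1 ≤ ∫ a : Irred (coord j), ((a.steps.sum j : ℤ) : ℝ) ∂(irredPMF j).toMeasure := by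
  have h1 : ∫ _ : Irred (coord j), (1 : ℝ) ∂(irredPMF j).toMeasure = 1 := by simp
  rw [← h1]
  refine integral_mono (integrable_const _)
    (integrable_of_abs_le hL fun a => abs_sum_coord_le a j) fun a => ?_
  have : 0 < a.steps.sum j := a.mem_dirBridges.2.sum_pos a.steps_ne_nil
  change (1 : ℝ) ≤ ((a.steps.sum j : ℤ) : ℝ)
  exact_mod_cast this

lemma measurable_eval_comp (h : Irred (coord j) → ℝ) (r : ℕ) :
    Measurable fun ω : ℕ → Irred (coord j) => h (ω r) :=
  (measurable_of_countable h).comp (measurable_pi_apply r)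

lemma ae_tendsto_length_div (hL : meanLength j ≠ ⊤) :
    ∀ᵐ ω ∂seqLaw j, Tendsto (fun r : ℕ => ((ω r).steps.length : ℝ) / r) atTop (𝓝 0) := by
  filter_upwards [seqLaw_strong_law _ (integrable_of_abs_le hL
    (h := fun a : Irred (coord j) => (a.steps.length : ℝ)) fun a => by simp)] with ω hω
  refine (tendsto_increment_div hω).congr fun n => ?_
  rw [Finset.sum_range_succ, add_sub_cancel_left]

/-- Along a typical sequence of irreducible bridges, the walk stays above a fixed level
in direction `coord i + coord j`. -/
lemma exists_mass_bounded_below (hij : i ≠ j) (hL : meanLength j ≠ ⊤) {δ : ℝ≥0∞} (hδ : 0 < δ) :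
    ∃ m : ℕ, ∀ M, 1 ≤ mass wordWeight {l : List (Irred (coord j)) | l.length = M ∧
      l ∈ {l | ∀ p a s, l = p ++ a :: s →
        -(m : ℤ) < (coord i + coord j) (concat p).sum - a.steps.length}} + δ := by
  set h : Irred (coord j) → ℝ := fun a => ((a.steps.sum i : ℤ) : ℝ) + ((a.steps.sum j : ℤ) : ℝ)
  have hI : Integrable h (irredPMF j).toMeasure :=
    (integrable_of_abs_le hL fun a => abs_sum_coord_le a i).add
      (integrable_of_abs_le hL fun a => abs_sum_coord_le a j)
  have hc : 0 < ∫ a, h a ∂(irredPMF j).toMeasure := by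
    rw [integral_add (integrable_of_abs_le hL fun a => abs_sum_coord_le a i)
      (integrable_of_abs_le hL fun a => abs_sum_coord_le a j), integral_transverse hij hL]
    linarith [one_le_integral_axial hL]
  -- Subtracting the length of the next letter controls the walk inside that letter too; the term is
  -- sublinear, so it does not change the drift.
  obtain ⟨m, hm⟩ := exists_measure_le_of_drift
    (T := fun r ω => ∑ k ∈ Finset.range r, h (ω k) - (ω r).steps.length)
    (fun r => (Finset.measurable_sum _ fun k _ => measurable_eval_comp h k).sub
      (measurable_eval_comp (fun a => (a.steps.length : ℝ)) r)) hc
    (by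
      filter_upwards [seqLaw_strong_law h hI, ae_tendsto_length_div hL] with ω h1 h2
      simpa [sub_div] using h1.sub h2) hδ
  refine ⟨m, fun M => one_sub_le_mass_of_drift hm fun ω hω p a s hl => ?_⟩
  obtain ⟨_, hp, ha⟩ := map_range_eq_append hl
  have h1 := hω p.length
  have h2 : (((coord i + coord j) (concat p).sum : ℤ) : ℝ) =
      ∑ k ∈ Finset.range p.length, h (ω k) := by
    conv_lhs => rw [concat_sum_map, hp, sum_map_range]
    push_cast
    simp [h]
  rw [← h2, ← ha] at h1
  exact_mod_cast h1

/-- Transverse displacements along a sequence of `M` irreducible bridges are `o(M)`. -/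
lemma exists_mass_transverse (hij : i ≠ j) (hL : meanLength j ≠ ⊤) {δ : ℝ≥0∞} (hδ : 0 < δ)
    {ε : ℝ} (hε : 0 < ε) :
    ∃ M₀ : ℕ, ∀ M ≥ M₀, 1 ≤ mass wordWeight {l : List (Irred (coord j)) | l.length = M ∧
      l ∈ {l | ∀ p a s, l = p ++ a :: s →
        |(((concat p).sum i : ℤ) : ℝ)| + a.steps.length ≤ ε * M}} + δ := by
  set h : Irred (coord j) → ℝ := fun a => ((a.steps.sum i : ℤ) : ℝ)
  have hI : Integrable h (irredPMF j).toMeasure :=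
    integrable_of_abs_le hL fun a => abs_sum_coord_le a i
  obtain ⟨m, hm⟩ := exists_measure_le_of_drift
    (T := fun r ω => ε / 2 * r - |∑ k ∈ Finset.range r, h (ω k)| - (ω r).steps.length)
    (fun r => (measurable_const.sub (_root_.continuous_abs.measurable.comp
      (Finset.measurable_sum _ fun k _ => measurable_eval_comp h k))).sub
      (measurable_eval_comp (fun a => (a.steps.length : ℝ)) r)) (half_pos hε)
    (by
      filter_upwards [seqLaw_strong_law h hI, ae_tendsto_length_div hL] with ω h1 h2
      rw [integral_transverse hij hL] at h1
      have h3 := ((tendsto_const_nhds (x := ε / 2)).sub h1.abs).sub h2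
      rw [abs_zero, sub_zero, sub_zero] at h3
      refine h3.congr' ?_
      filter_upwards [eventually_gt_atTop 0] with r hr
      have hr' : (0 : ℝ) < r := by exact_mod_cast hr
      rw [abs_div, abs_of_pos hr']
      field_simp) hδ
  -- Half of `ε * M` pays for the term `ε / 2 * r` with `r ≤ M`, the other half for the constant
  -- `m`.
  obtain ⟨M₀, hM₀⟩ := exists_nat_gt (m / (ε / 2))
  refine ⟨M₀, fun M hM => one_sub_le_mass_of_drift hm fun ω hω p a s hl => ?_⟩
  obtain ⟨hlt, hp, ha⟩ := map_range_eq_append hl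
  have h1 := hω p.length
  have h2 : ((coord i (concat p).sum : ℤ) : ℝ) = ∑ k ∈ Finset.range p.length, h (ω k) := by
    conv_lhs => rw [concat_sum_map, hp, sum_map_range]
    push_cast
    simp [h]
  rw [← h2, ← ha, coord_apply] at h1
  rw [div_lt_iff₀ (half_pos hε)] at hM₀
  have h3 : (M₀ : ℝ) ≤ M := by exact_mod_cast hM
  have h4 : (p.length : ℝ) ≤ M := by exact_mod_cast hlt.le
  have h5 := mul_le_mul_of_nonneg_left h3 (half_pos hε).le
  have h6 := mul_le_mul_of_nonneg_left h4 (half_pos hε).le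
  linarith

/-- The total length of `M` irreducible bridges is of order `M`. -/
lemma exists_mass_length (hL : meanLength j ≠ ⊤) {δ : ℝ≥0∞} (hδ : 0 < δ) :
    ∃ C : ℕ, ∀ M ≥ 1, 1 ≤ mass wordWeight {l : List (Irred (coord j)) | l.length = M ∧
      l ∈ {l | (concat l).length ≤ C * M}} + δ := by
  set h : Irred (coord j) → ℝ := fun a => a.steps.length
  have hI : Integrable h (irredPMF j).toMeasure := integrable_of_abs_le hL fun a => by simp [h]
  set E := ∫ a, h a ∂(irredPMF j).toMeasure
  -- Using `E + 1` in place of the mean `E` leaves a drift of exactly 1.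
  obtain ⟨m, hm⟩ := exists_measure_le_of_drift
    (T := fun r ω => (E + 1) * r - ∑ k ∈ Finset.range r, h (ω k))
    (fun r => measurable_const.sub
      (Finset.measurable_sum _ fun k _ => measurable_eval_comp h k)) one_pos
    (by
      filter_upwards [seqLaw_strong_law h hI] with ω h1
      have h3 := (tendsto_const_nhds (x := E + 1)).sub h1
      rw [add_sub_cancel_left] at h3
      refine h3.congr' ?_
      filter_upwards [eventually_gt_atTop 0] with r hr
      have hr' : (0 : ℝ) < r := by exact_mod_cast hr
      field_simp) hδ
  obtain ⟨C, hC⟩ := exists_nat_gt (E + 1 + m)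
  refine ⟨C, fun M hM => one_sub_le_mass_of_drift hm fun ω hω => ?_⟩
  have h1 := hω M
  have h2 : ((concat ((List.range M).map ω)).length : ℝ) = ∑ k ∈ Finset.range M, h (ω k) := by
    rw [length_concat, sum_map_range]
    push_cast
    rfl
  rw [← h2] at h1
  have hM' : (1 : ℝ) ≤ M := by exact_mod_cast hM
  have h3 : ((concat ((List.range M).map ω)).length : ℝ) ≤ C * M := by nlinarith
  exact_mod_cast h3

end FiniteMean

/-! ### Bridges in a diagonal direction -/

/-- Locates time `k` inside one letter, so that conditions on prefixes of a word give bounds at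
every site of the walk. -/
lemma exists_pos_concat {g : (Fin d → ℤ) →+ ℤ} {l : List (Irred g)} (hl : l ≠ []) {k : ℕ}
    (hk : k ≤ (concat l).length) : ∃ p a s t, l = p ++ a :: s ∧ t ≤ a.steps.length ∧
      pos (concat l) k = (concat p).sum + pos a.steps t := by
  induction l generalizing k with
  | nil => exact absurd rfl hl
  | cons a l ih =>
    rw [concat_cons] at hk ⊢
    rcases le_or_gt k a.steps.length with h | h
    · exact ⟨[], a, l, k, rfl, h, by simp [pos_append_left h]⟩
    · obtain ⟨n, rfl⟩ := Nat.exists_eq_add_of_lt h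
      rw [List.length_append] at hk
      have hne : l ≠ [] := by rintro rfl; rw [concat_nil, List.length_nil] at hk; omega
      obtain ⟨p, b, s, t, rfl, ht, he⟩ := ih hne (k := n + 1) (by omega)
      refine ⟨a :: p, b, s, t, rfl, ht, ?_⟩
      rw [add_assoc, pos_append_right, he, concat_cons, List.sum_append, add_assoc]

lemma mass_words_axial (j : Fin d) (M : ℕ) :
    mass wordWeight {l : List (Irred (coord j)) | l.length = M} = 1 := by
  rw [mass_words_univ, tsum_irredWeight, one_pow]

/-- By Kesten's relation the `M`-letter words form a probability space; intersecting with an event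
of probability at least `1 - δ` costs at most `δ`. -/
lemma one_le_mass_inter {j : Fin d} {M : ℕ} {Q₁ Q₂ : Set (List (Irred (coord j)))}
    {c δ : ℝ≥0∞}
    (h₁ : c ≤ mass wordWeight {l | l.length = M ∧ l ∈ Q₁})
    (h₂ : 1 ≤ mass wordWeight {l | l.length = M ∧ l ∈ Q₂} + δ) :
    c ≤ mass wordWeight {l | l.length = M ∧ l ∈ Q₁ ∩ Q₂} + δ := by
  have h := mass_inter_ge (u := wordWeight)
    (S := {l : List (Irred (coord j)) | l.length = M ∧ l ∈ Q₁}) (T := {l | l.length = M ∧ l ∈ Q₂})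
    (U := {l | l.length = M}) (fun l hl => hl.1) (fun l hl => hl.1)
  rw [mass_words_axial] at h
  have hset : {l : List (Irred (coord j)) | l.length = M ∧ l ∈ Q₁} ∩ {l | l.length = M ∧ l ∈ Q₂} =
      {l | l.length = M ∧ l ∈ Q₁ ∩ Q₂} := by
    ext l; simp only [Set.mem_inter_iff, Set.mem_ofPred_eq]; tauto
  rw [hset] at h
  refine (ENNReal.add_le_add_iff_right ENNReal.one_ne_top).1 ?_
  calc c + 1 ≤ mass wordWeight {l | l.length = M ∧ l ∈ Q₁} +
        (mass wordWeight {l | l.length = M ∧ l ∈ Q₂} + δ) := add_le_add h₁ h₂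
    _ ≤ mass wordWeight {l | l.length = M ∧ l ∈ Q₁ ∩ Q₂} + 1 + δ := by
        rw [← add_assoc]; gcongr
    _ = _ := by ring

section Diagonal

variable {i j : Fin d}

lemma abs_diag_pos_le (hij : i ≠ j) {w : List (Fin d → ℤ)} (h : ∀ s ∈ w, IsStep s) (k : ℕ) :
    |(coord i + coord j) (pos w k)| ≤ k :=
  abs_coord_add_pos_le h hij k

lemma le_pos_concat (hij : i ≠ j) {m : ℕ} {l : List (Irred (coord j))}
    (h : ∀ p a s, l = p ++ a :: s →
      -(m : ℤ) < (coord i + coord j) (concat p).sum - a.steps.length) {k : ℕ}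
    (hk : k ≤ (concat l).length) : -(m : ℤ) ≤ (coord i + coord j) (pos (concat l) k) := by
  by_cases hl : l = []
  · subst hl; simp [pos]
  obtain ⟨p, a, s, t, hs, ht, he⟩ := exists_pos_concat hl hk
  have h1 := h p a s hs
  have h2 := (abs_le.1 (abs_diag_pos_le hij a.mem_dirBridges.1.1 t)).1
  rw [he, map_add]
  omega

/-- What matters is the displacement still to come: the rest of the current letter plus the later
letters. A sum ignores order, so the later letters may be read as a prefix of the reversed word.
Only the order of the letters is reversed, not the letters themselves. -/
lemma pos_concat_le (hij : i ≠ j) {m : ℕ} {l : List (Irred (coord j))}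
    (h : ∀ p a s, l.reverse = p ++ a :: s →
      -(m : ℤ) < (coord i + coord j) (concat p).sum - a.steps.length) {k : ℕ}
    (hk : k ≤ (concat l).length) :
    (coord i + coord j) (pos (concat l) k) ≤ (coord i + coord j) (concat l).sum + m := by
  by_cases hl : l = []
  · subst hl; simp [pos]
  obtain ⟨p, a, s, t, hs, ht, he⟩ := exists_pos_concat hl hk
  have h1 := h s.reverse a p.reverse (by simp [hs])
  have h2 : (coord i + coord j) (concat s.reverse).sum = (coord i + coord j) (concat s).sum := by
    rw [concat_sum_map, concat_sum_map, List.map_reverse, List.sum_reverse]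
  have h3 := (abs_le.1 (abs_diag_pos_le hij (a.mem_dirBridges.1.drop t).1
    (a.steps.drop t).length)).1
  rw [pos_length, sum_drop, map_sub, List.length_drop] at h3
  rw [he, hs, concat_append, concat_cons, List.sum_append, List.sum_append, map_add, map_add,
    map_add]
  omega

lemma diag_pos_replicate (hij : i ≠ j) {n k : ℕ} (h : k ≤ n) :
    (coord i + coord j) (pos (List.replicate n (Pi.single j 1 : Fin d → ℤ)) k) = k := by
  rw [pos, List.take_replicate, min_eq_left h, List.sum_replicate]
  simp [hij]

/-- Straight pieces at both ends turn a walk that stays between two levels into a bridge. -/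
lemma isDirBridge_pad (hij : i ≠ j) {m : ℕ} {c : List (Fin d → ℤ)}
    (hlow : ∀ k, k ≤ c.length → -(m : ℤ) ≤ (coord i + coord j) (pos c k))
    (hup : ∀ k, k ≤ c.length → (coord i + coord j) (pos c k) ≤ (coord i + coord j) c.sum + m) :
    IsDirBridge (coord i + coord j) (List.replicate (m + 1) (Pi.single j 1) ++
      (c ++ List.replicate (m + 1) (Pi.single j 1))) := by
  set f := coord i + coord j
  set e : List (Fin d → ℤ) := List.replicate (m + 1) (Pi.single j 1)
  have hel : e.length = m + 1 := by simp [e]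
  have hes : f e.sum = (m + 1 : ℕ) := by
    have := diag_pos_replicate hij (le_refl (m + 1))
    rwa [← pos_length, hel]
  have hc : -(m : ℤ) ≤ f c.sum := by
    have := hlow c.length le_rfl
    rwa [pos_length] at this
  have key : ∀ k, k ≤ (e ++ (c ++ e)).length → (k = 0 ∨ 0 < f (pos (e ++ (c ++ e)) k)) ∧
      f (pos (e ++ (c ++ e)) k) ≤ f (e ++ (c ++ e)).sum := by
    intro k hk
    rw [List.sum_append, List.sum_append, map_add, map_add, hes]
    simp only [List.length_append, hel] at hk
    rcases le_or_gt k e.length with h1 | h1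
    · rw [pos_append_left h1, diag_pos_replicate hij (hel ▸ h1)]
      omega
    obtain ⟨k, rfl⟩ := Nat.exists_eq_add_of_le h1.le
    rw [pos_append_right, map_add, hes]
    rcases le_or_gt k c.length with h2 | h2
    · rw [pos_append_left h2]
      have := hlow k h2
      have := hup k h2
      push_cast
      omega
    obtain ⟨k, rfl⟩ := Nat.exists_eq_add_of_le h2.le
    rw [pos_append_right, map_add, diag_pos_replicate hij (by omega)]
    push_cast
    omega
  exact ⟨fun k h0 hk => (key k hk).1.resolve_left h0.ne', fun k hk => (key k hk).2⟩

/-- A single step, as an irreducible bridge. -/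
def Irred.single (j : Fin d) : Irred (coord j) where
  steps := [Pi.single j 1]
  isIrredBridge := ⟨by simp, ⟨isSelfAvoiding_single j, isDirBridge_single (by simp)⟩,
    fun k h1 h2 => by simp at h2; omega⟩

lemma concat_replicate_single (j : Fin d) (n : ℕ) :
    concat (List.replicate n (Irred.single j)) = List.replicate n (Pi.single j 1) := by
  induction n with
  | zero => rfl
  | succ n ih => rw [List.replicate_succ, concat_cons, ih]; rfl

lemma wordWeight_reverse {g : (Fin d → ℤ) →+ ℤ} (l : List (Irred g)) :
    wordWeight l.reverse = wordWeight l := by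
  rw [wordWeight_eq_prod, wordWeight_eq_prod, List.map_reverse, List.prod_reverse]

/-- A uniformly positive proportion of the concatenations of `M` irreducible bridges is a bridge
in the diagonal direction. -/
lemma exists_le_mass_diag (hij : i ≠ j) (hL : meanLength j ≠ ⊤) :
    ∃ q : ℝ≥0∞, 0 < q ∧ q ≠ ⊤ ∧ ∃ M₀, ∀ M ≥ M₀, q ≤ mass wordWeight
      {l : List (Irred (coord j)) | l.length = M ∧
        l ∈ {l | IsDirBridge (coord i + coord j) (concat l)}} := by
  -- The lower bound and, through reversal of words, the upper bound each fail with probability at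
  -- most `1/4`, so both hold on a set of mass at least `4⁻¹` (in fact `1/2`).
  obtain ⟨m, hm⟩ := exists_mass_bounded_below hij hL (δ := 4⁻¹) (by simp)
  set A := {l : List (Irred (coord j)) | ∀ p a s, l = p ++ a :: s →
        -(m : ℤ) < (coord i + coord j) (concat p).sum - a.steps.length}
  have hA' : ∀ M, 1 ≤ mass wordWeight {l | l.length = M ∧ l ∈ List.reverse ⁻¹' A} + 4⁻¹ := by
    intro M
    refine (hm M).trans (add_le_add_left ?_ _)
    refine mass_le_of_injOn List.reverse (fun l hl => ⟨?_, ?_⟩) List.reverse_injective.injOn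
      fun l _ => (wordWeight_reverse l).ge
    · rw [List.length_reverse]; exact hl.1
    · rw [Set.mem_preimage, List.reverse_reverse]; exact hl.2
  have hmid : ∀ M, (4⁻¹ : ℝ≥0∞) ≤
      mass wordWeight {l | l.length = M ∧ l ∈ A ∩ List.reverse ⁻¹' A} := by
    intro M
    have h1 : (2⁻¹ : ℝ≥0∞) ≤ mass wordWeight {l | l.length = M ∧ l ∈ A} := by
      have := tsub_le_iff_right.2 (hm M)
      refine le_trans ?_ this
      refine ENNReal.le_sub_of_add_le_right (by simp) ?_
      rw [← ENNReal.toReal_le_toReal (by simp) (by simp), ENNReal.toReal_add (by simp) (by simp)]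
      norm_num
    have h2 := tsub_le_iff_right.2 (one_le_mass_inter h1 (hA' M))
    refine le_trans ?_ h2
    refine ENNReal.le_sub_of_add_le_right (by simp) ?_
    rw [← ENNReal.toReal_le_toReal (by simp) (by simp), ENNReal.toReal_add (by simp) (by simp)]
    norm_num
  -- The straight padding is itself made of irreducible letters, so the padded word has `2 * (m +
  -- 1)` more letters and a weight changed by a factor independent of `M`.
  set E := List.replicate (m + 1) (Irred.single j)
  refine ⟨wordWeight E * wordWeight E * 4⁻¹, ?_, ?_, 2 * (m + 1), fun M hM => ?_⟩
  · have : 0 < wordWeight E := by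
      rw [wordWeight, walkWeight]
      exact ENNReal.pow_pos (critWeight_pos j.pos) _
    exact ENNReal.mul_pos (ENNReal.mul_pos this.ne' this.ne').ne' (by simp)
  · have : wordWeight E ≠ ⊤ := ENNReal.pow_ne_top critWeight_ne_top
    exact ENNReal.mul_ne_top (ENNReal.mul_ne_top this this) (by simp)
  · obtain ⟨M, rfl⟩ := Nat.exists_eq_add_of_le hM
    refine (mul_le_mul_right (hmid M) _).trans ?_
    rw [← mass_const_mul]
    refine mass_le_of_injOn (fun l => E ++ (l ++ E)) (fun l hl => ⟨?_, ?_⟩)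
      (fun l _ l' _ h => by simpa using h) fun l _ => ?_
    · have : E.length = m + 1 := by simp [E]
      rw [List.length_append, List.length_append, this, hl.1]; ring
    · change IsDirBridge _ (concat (E ++ (l ++ E)))
      rw [concat_append, concat_append, concat_replicate_single]
      exact isDirBridge_pad hij (fun k hk => le_pos_concat hij hl.2.1 hk)
        fun k hk => pos_concat_le hij hl.2.2 hk
    · rw [wordWeight_append, wordWeight_append]
      exact le_of_eq (by ring)

/-! ### Turning one straight piece against another -/

/-- Words of irreducible bridges of at least `N` and less than `2 * N` letters, whose concatenation
is a diagonal bridge with length at most `K` and transverse displacement at most `D`. -/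
def straightWords (i j : Fin d) (N K D : ℕ) : Set (List (Irred (coord j))) :=
  {l | (IsDirBridge (coord i + coord j) (concat l) ∧ (concat l).length ≤ K ∧
    ∀ k, k ≤ (concat l).length → |pos (concat l) k i| ≤ D) ∧ l.length ∈ Finset.Ico N (2 * N)}

/-- The turning point is determined by the turned walk and by the height of the turning point
modulo `3 * D + 1`. -/
lemma not_length_lt_of_turn_eq {D : ℕ} {a a' b b' : List (Fin d → ℤ)}
    (ha : |a.sum i| ≤ D) (ha' : |a'.sum i| ≤ D) (hb : IsDirBridge (coord i + coord j) b)
    (hbD : ∀ k, k ≤ b.length → |pos b k i| ≤ D)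
    (h : a ++ b.map (swapCoord i j) = a' ++ b'.map (swapCoord i j))
    (hmod : ((((coord i + coord j) a.sum : ℤ)) : ZMod (3 * D + 1)) =
      (((coord i + coord j) a'.sum : ℤ))) :
    ¬ a.length < a'.length := by
  intro hlt
  rcases List.append_eq_append_iff.1 h with ⟨c, rfl, hc⟩ | ⟨c, rfl, hc⟩
  · have hcl : c.length ≤ b.length := by
      have := congrArg List.length hc
      simp only [List.length_map, List.length_append] at this
      omega
    have hc0 : 0 < c.length := by simpa using hlt
    have hcs : c.sum = swapCoord i j (pos b c.length) := by
      rw [← pos_map, hc, pos_append_left le_rfl, pos_length]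
    have hci : c.sum i = pos b c.length j := by rw [hcs, swapCoord_apply, Equiv.swap_apply_left]
    have hcj : c.sum j = pos b c.length i := by rw [hcs, swapCoord_apply, Equiv.swap_apply_right]
    -- The diagonal increment along `c` lies strictly between 0 and `3 * D + 1`, so the modulus
    -- cannot divide it. It is positive because the exchange of coordinates preserves the diagonal
    -- direction in which `b` is a bridge. Its `i` part is at most `2 * D`, since `a` and `a ++ c`
    -- both end within `D`; its `j` part is an `i`-coordinate of `b`, at most `D`.
    have hpos := hb.1 c.length hc0 hcl
    have hD := hbD c.length hcl
    rw [ZMod.intCast_eq_intCast_iff_dvd_sub, List.sum_append, map_add, add_sub_cancel_left] at hmod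
    simp only [AddMonoidHom.add_apply, coord_apply, List.sum_append, Pi.add_apply] at *
    have hle := Int.le_of_dvd (by omega) hmod
    rw [abs_le] at *
    push_cast at hle
    omega
  · simp at hlt

lemma diag_swapCoord (s : Fin d → ℤ) :
    (coord i + coord j) (swapCoord i j s) = (coord i + coord j) s := by
  simp [swapCoord_apply, add_comm]

/-- Turning the second of two straight pieces gives many diagonal bridges. -/
lemma mass_straightWords_sq_le (N K D : ℕ) :
    mass wordWeight (straightWords i j N K D) * mass wordWeight (straightWords i j N K D) ≤
      (2 * K + 1) * (3 * D + 1) := by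
  set S := straightWords i j N K D
  set f := coord i + coord j
  set T := {w : List (Fin d → ℤ) | w ∈ dirBridges f ∧ w.length ≤ 2 * K}
  have hT : mass walkWeight T ≤ 2 * K + 1 := by
    have := mass_dirBridges_length_le i.pos f (2 * K)
    exact_mod_cast this
  have hZ : mass (fun _ : ZMod (3 * D + 1) => (1 : ℝ≥0∞)) Set.univ = 3 * D + 1 := by
    rw [mass_univ, ENNReal.tsum_const, ENat.card_eq_coe_fintype_card, ZMod.card]
    simp
  rw [← mass_prod]
  calc _ ≤ mass (fun p : List (Fin d → ℤ) × ZMod (3 * D + 1) => walkWeight p.1 * 1)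
        (T ×ˢ Set.univ) := ?_
    _ = mass walkWeight T * (3 * D + 1) := by rw [mass_prod (v := fun _ => 1), hZ]
    _ ≤ _ := mul_le_mul_left hT _
  -- The residue of the height at the turning point is the only extra information needed to undo the
  -- turn; it has `3 * D + 1` possible values.
  refine mass_le_of_injOn (fun p => (concat p.1 ++ (concat p.2).map (swapCoord i j),
    ((f (concat p.1).sum : ℤ) : ZMod (3 * D + 1)))) ?_ ?_ ?_
  · rintro ⟨l, m⟩ ⟨hl, hm⟩
    refine ⟨⟨dirBridges_append ⟨(concat_mem_dirBridges l).1, hl.1.1⟩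
      ⟨(concat_mem_dirBridges m).1.map (swapCoord_injective i j) fun s hs => hs.swapCoord i j,
        hm.1.1.map diag_swapCoord⟩, ?_⟩, trivial⟩
    have h1 : (concat l).length ≤ K := hl.1.2.1
    have h2 : (concat m).length ≤ K := hm.1.2.1
    simp only [List.length_append, List.length_map]
    omega
  · rintro ⟨l, m⟩ ⟨hl, hm⟩ ⟨l', m'⟩ ⟨hl', hm'⟩ h
    simp only [Prod.mk.injEq] at h
    have hD : ∀ v ∈ S, |(concat v).sum i| ≤ D := fun v hv => by
      simpa using hv.1.2.2 _ le_rfl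
    have h1 := not_length_lt_of_turn_eq (hD l hl) (hD l' hl') hm.1.1 hm.1.2.2 h.1 h.2
    have h2 := not_length_lt_of_turn_eq (hD l' hl') (hD l hl) hm'.1.1 hm'.1.2.2 h.1.symm h.2.symm
    obtain ⟨h3, h4⟩ := List.append_inj h.1 (le_antisymm (not_lt.1 h2) (not_lt.1 h1))
    exact Prod.ext (concat_injective h3)
      (concat_injective (List.map_injective_iff.2 (swapCoord_injective i j) h4))
  · rintro ⟨l, m⟩ _
    rw [walkWeight_append, mul_one]
    simp [wordWeight, walkWeight]

/-- The `N` possible word lengths give disjoint families. This factor `N`, squared after pairing, is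
what must beat the linear mass of the target bridges. -/
lemma le_mass_straightWords {N K D : ℕ} {c : ℝ≥0∞}
    (h : ∀ M, N ≤ M → M < 2 * N → c ≤ mass wordWeight {l : List (Irred (coord j)) |
      (IsDirBridge (coord i + coord j) (concat l) ∧ (concat l).length ≤ K ∧
        ∀ k, k ≤ (concat l).length → |pos (concat l) k i| ≤ D) ∧ l.length = M}) :
    N * c ≤ mass wordWeight (straightWords i j N K D) := by
  have h1 := mass_fiber_sum (u := wordWeight) (Finset.Ico N (2 * N)) List.length
    {l : List (Irred (coord j)) | IsDirBridge (coord i + coord j) (concat l) ∧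
      (concat l).length ≤ K ∧ ∀ k, k ≤ (concat l).length → |pos (concat l) k i| ≤ D}
  have h2 := Finset.card_nsmul_le_sum (Finset.Ico N (2 * N)) _ c
    fun M hM => h M (Finset.mem_Ico.1 hM).1 (Finset.mem_Ico.1 hM).2
  rw [Nat.card_Ico, two_mul, Nat.add_sub_cancel, nsmul_eq_mul] at h2
  rw [← two_mul] at h2
  exact h2.trans h1.ge

end Diagonal

lemma abs_pos_concat_le {i j : Fin d} {l : List (Irred (coord j))} {c : ℝ}
    (h : ∀ p a s, l = p ++ a :: s → |(((concat p).sum i : ℤ) : ℝ)| + a.steps.length ≤ c)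
    {k : ℕ} (hk : k ≤ (concat l).length) : |pos (concat l) k i| ≤ (⌊c⌋₊ : ℤ) := by
  by_cases hl : l = []
  · subst hl; simp [pos]
  obtain ⟨p, a, s, t, hs, ht, he⟩ := exists_pos_concat hl hk
  have h1 := h p a s hs
  have h2 : |((pos a.steps t i : ℤ) : ℝ)| ≤ a.steps.length := by
    have := abs_coord_pos_le a.mem_dirBridges.1.1 i t
    exact_mod_cast this.trans (by exact_mod_cast ht)
  have h3 := abs_add_le (((concat p).sum i : ℤ) : ℝ) ((pos a.steps t i : ℤ) : ℝ)
  rw [Int.abs_eq_natAbs, Int.ofNat_le]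
  refine Nat.le_floor ?_
  rw [Nat.cast_natAbs, he, Pi.add_apply]
  push_cast
  linarith

/-- Irreducible bridges have infinite mean length. -/
theorem meanLength_eq_top {i j : Fin d} (hij : i ≠ j) : meanLength j = ⊤ := by
  by_contra hL
  obtain ⟨q, hq0, hqt, M₁, hM₁⟩ := exists_le_mass_diag hij hL
  -- Of the mass `4 * δ` of diagonal bridges, the length bound and the transverse bound each cost
  -- `δ`, leaving `2 * δ`.
  obtain ⟨δ, rfl⟩ : ∃ δ : ℝ≥0∞, q = 4 * δ :=
    ⟨q / 4, (ENNReal.mul_div_cancel (by simp) (by simp)).symm⟩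
  have hδ0 : 0 < δ := pos_of_ne_zero fun h => by simp [h] at hq0
  have hδt : δ ≠ ⊤ := fun h => by simp [h] at hqt
  set r := δ.toReal
  have hr : 0 < r := ENNReal.toReal_pos hδ0.ne' hδt
  obtain ⟨C, hC⟩ := exists_mass_length hL hδ0
  -- Chosen so that the final upper bound `5 * (C + 1) * N * (7 * (ε * N))` equals `7 / 2 * (r * N)
  -- ^ 2`, below the lower bound `4 * (r * N) ^ 2`.
  set ε : ℝ := r ^ 2 / (10 * (C + 1)) with hε
  have hε0 : 0 < ε := by positivity
  obtain ⟨M₂, hM₂⟩ := exists_mass_transverse hij hL hδ0 hε0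
  -- Ensures `1 ≤ ε * N`, which absorbs the additive 1 in `3 * D + 1`.
  obtain ⟨N₀, hN₀⟩ := exists_nat_gt (1 / ε)
  set N := M₁ + M₂ + N₀ + 1 with hN
  have hS : (N : ℝ≥0∞) * (2 * δ) ≤
      mass wordWeight (straightWords i j N (C * (2 * N)) ⌊ε * (2 * N)⌋₊) := by
    refine le_mass_straightWords fun M h1 h2 => ?_
    have h3 : 3 * δ ≤ _ := (ENNReal.add_le_add_iff_right hδt).1
      ((le_of_eq (by ring)).trans (one_le_mass_inter (hM₁ M (by omega)) (hC M (by omega))))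
    have h4 : 2 * δ ≤ _ := (ENNReal.add_le_add_iff_right hδt).1
      ((le_of_eq (by ring)).trans (one_le_mass_inter h3 (hM₂ M (by omega))))
    refine h4.trans (mass_mono ?_)
    rintro l ⟨hlM, ⟨hl1, hl2⟩, hl3⟩
    refine ⟨⟨hl1, le_trans hl2 (Nat.mul_le_mul_left C h2.le), fun k hk => ?_⟩, hlM⟩
    refine abs_pos_concat_le (fun p a s hs => (hl3 p a s hs).trans ?_) hk
    have : (M : ℝ) ≤ 2 * N := by exact_mod_cast h2.le
    gcongr
  have h1 := (mul_le_mul' hS hS).trans (mass_straightWords_sq_le _ _ _)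
  have h2 := ENNReal.toReal_mono (by finiteness) h1
  set D := ⌊ε * (2 * N)⌋₊
  have hD : (D : ℝ) ≤ ε * (2 * N) := Nat.floor_le (by positivity)
  have hR : ((2 * ((C * (2 * N) : ℕ) : ℝ≥0∞) + 1) * (3 * (D : ℝ≥0∞) + 1)).toReal =
      (2 * (C * (2 * N)) + 1) * (3 * D + 1) := by
    have : (2 * ((C * (2 * N) : ℕ) : ℝ≥0∞) + 1) * (3 * (D : ℝ≥0∞) + 1) =
        (((2 * (C * (2 * N)) + 1) * (3 * D + 1) : ℕ) : ℝ≥0∞) := by push_cast; ring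
    rw [this, ENNReal.toReal_natCast]
    push_cast; ring
  have hl : ((N : ℝ≥0∞) * (2 * δ) * (N * (2 * δ))).toReal = N * (2 * r) * (N * (2 * r)) := by
    simp only [ENNReal.toReal_mul, ENNReal.toReal_natCast, ENNReal.toReal_ofNat]
    rfl
  rw [hR, hl] at h2
  have hN1 : (1 : ℝ) ≤ N := by exact_mod_cast (show 1 ≤ N by omega)
  have hNε : 1 ≤ ε * N := by
    rw [div_lt_iff₀ hε0] at hN₀
    have : (N₀ : ℝ) ≤ N := by exact_mod_cast (show N₀ ≤ N by omega)
    nlinarith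
  have hC0 : (0 : ℝ) ≤ C := Nat.cast_nonneg C
  have h3 : (2 * (C * (2 * N)) + 1 : ℝ) * (3 * D + 1) ≤ (5 * (C + 1) * N) * (7 * (ε * N)) := by
    refine mul_le_mul ?_ ?_ (by positivity) (by positivity)
    · nlinarith
    · linarith
  have h4 : (5 * (C + 1) * N : ℝ) * (7 * (ε * N)) = 7 / 2 * (r * N) ^ 2 := by
    rw [hε]; field_simp; ring
  have h5 : 0 < (r * N) ^ 2 := by positivity
  rw [h4] at h3
  nlinarith

/-! ### Irreducible bridges as maps and as lists of steps -/

/-- The bridge conditions involve only height differences, so the segment may be translated to the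
origin and read off from its own steps. -/
lemma isBridgeOn_iff {n : ℕ} (hd : 2 ≤ d) (γ : Fin (n + 1) → Fin d → ℤ) {i j : Fin (n + 1)}
    (hij : i ≤ j) : IsBridgeOn hd γ i j ↔ IsSAW γ ∧
      IsDirBridge (coord ⟨1, hd⟩) (((stepsOf γ).drop i).take (j - i)) := by
  have hij' : (i : ℕ) ≤ j := hij
  have hj : (j : ℕ) ≤ n := Nat.lt_succ_iff.1 j.2
  have hlen : (((stepsOf γ).drop i).take (j - i)).length = j - i := by
    simp; omega
  have hpos : ∀ k (hk : k ≤ (j : ℕ) - i), pos (((stepsOf γ).drop i).take (j - i)) k =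
      γ ⟨i + k, by omega⟩ - γ i := fun k hk => by
    rw [pos_take hk, pos_drop (by simp; omega), pos_stepsOf γ i]
    have := pos_stepsOf γ ⟨i + k, by omega⟩
    simp only at this
    rw [this]; abel
  have hsum : (((stepsOf γ).drop i).take (j - i)).sum = γ j - γ i := by
    have h1 : pos (((stepsOf γ).drop i).take (j - i)) (j - i) =
        (((stepsOf γ).drop i).take (j - i)).sum := by
      rw [pos, List.take_take, min_self]
    rw [← h1, hpos _ le_rfl]
    congr 2
    ext
    simp only; omega
  unfold IsBridgeOn IsDirBridge
  rw [hlen, hsum]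
  simp only [hij, true_and]
  refine and_congr_right fun _ => and_congr ⟨fun h k h0 hk => ?_, fun h k h0 hk => ?_⟩
    ⟨fun h k hk => ?_, fun h k h0 hk => ?_⟩
  · rw [hpos k hk, map_sub, sub_pos]
    exact h _ (Fin.lt_def.2 (by simp only; omega)) (Fin.le_def.2 (by simp only; omega))
  · have h1 := h (k - i) (by have := Fin.lt_def.1 h0; omega) (by have := Fin.le_def.1 hk; omega)
    rw [hpos _ (by have := Fin.le_def.1 hk; omega), map_sub, sub_pos] at h1
    have : (⟨i + (k - i), by have := k.2; have := Fin.lt_def.1 h0; omega⟩ : Fin (n + 1)) = k := by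
      ext; have := Fin.lt_def.1 h0; simp only; omega
    rw [this] at h1
    exact h1
  · rw [hpos k hk, map_sub, map_sub, sub_le_sub_iff_right]
    exact h _ (Fin.le_def.2 (by simp only; omega)) (Fin.le_def.2 (by simp only; omega))
  · have h1 := h (k - i) (by have := Fin.le_def.1 hk; omega)
    rw [hpos _ (by have := Fin.le_def.1 hk; omega), map_sub, map_sub,
      sub_le_sub_iff_right] at h1
    have : (⟨i + (k - i), by have := k.2; have := Fin.le_def.1 h0; omega⟩ : Fin (n + 1)) = k := by
      ext; have := Fin.le_def.1 h0; simp only; omega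
    rw [this] at h1
    exact h1

lemma isBridge_iff {n : ℕ} (hd : 2 ≤ d) (γ : Fin (n + 1) → Fin d → ℤ) :
    IsBridge hd γ ↔ stepsOf γ ∈ dirBridges (coord ⟨1, hd⟩) := by
  rw [IsBridge, isBridgeOn_iff hd γ (Fin.zero_le _), isSAW_iff]
  simp [dirBridges, List.take_of_length_le]

lemma isRenewal_iff {n : ℕ} (hd : 2 ≤ d) (γ : Fin (n + 1) → Fin d → ℤ) (k : Fin (n + 1)) :
    IsRenewal hd γ k ↔ IsSAW γ ∧ IsDirBridge (coord ⟨1, hd⟩) ((stepsOf γ).take k) ∧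
      IsDirBridge (coord ⟨1, hd⟩) ((stepsOf γ).drop k) := by
  rw [IsRenewal, isBridgeOn_iff hd γ (Fin.zero_le _), isBridgeOn_iff hd γ (Fin.le_last _)]
  rw [List.take_of_length_le (l := (stepsOf γ).drop k) (by simp)]
  simp only [Fin.val_zero, List.drop_zero, Nat.sub_zero]
  tauto

lemma isIrreducibleBridge_iff {n : ℕ} (hd : 2 ≤ d) (γ : Fin (n + 1) → Fin d → ℤ) :
    IsIrreducibleBridge hd γ ↔ IsIrredBridge (coord ⟨1, hd⟩) (stepsOf γ) := by
  rw [IsIrreducibleBridge, IsIrredBridge, isBridge_iff]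
  refine and_congr ?_ (and_congr_right fun hb => ⟨fun h k h0 hk hc => ?_, fun h k h0 hk hc => ?_⟩)
  · rw [← List.length_pos_iff, length_stepsOf]; rfl
  · rw [length_stepsOf] at hk
    refine h ⟨k, by omega⟩ (Fin.lt_def.2 h0) (Fin.lt_def.2 hk) ?_
    rw [isRenewal_iff, isSAW_iff]
    exact ⟨hb.1, hc⟩
  · exact h k (Fin.lt_def.1 h0) (by rw [length_stepsOf]; exact Fin.lt_def.1 hk)
      ((isRenewal_iff hd γ k).1 hc).2

/-- The list of steps of an irreducible bridge. -/
def toIrred (hd : 2 ≤ d) (γ : IrreducibleBridge hd) : Irred (coord (⟨1, hd⟩ : Fin d)) :=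
  ⟨stepsOf γ.walk, (isIrreducibleBridge_iff hd γ.walk).1 γ.irreducible⟩

lemma length_toIrred (hd : 2 ≤ d) (γ : IrreducibleBridge hd) :
    (toIrred hd γ).steps.length = γ.length := length_stepsOf _

lemma toIrred_bijective (hd : 2 ≤ d) : Function.Bijective (toIrred hd) := by
  constructor
  · rintro ⟨n, γ, h0, h⟩ ⟨n', γ', h0', h'⟩ he
    have hs : stepsOf γ = stepsOf γ' := congrArg Irred.steps he
    obtain rfl : n = n' := by simpa using congrArg List.length hs
    obtain rfl : γ = γ' := by
      funext k
      have h1 := pos_stepsOf γ k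
      rw [hs, pos_stepsOf, h0, h0', sub_zero, sub_zero] at h1
      exact h1.symm
    rfl
  · rintro ⟨w, hw⟩
    have hw' := stepsOf_pos (w := w) rfl
    refine ⟨⟨w.length, fun k => pos w k, by simp, ?_⟩, Irred.ext hw'⟩
    rw [isIrreducibleBridge_iff, hw']
    exact hw

lemma ofReal_inv_pow_length (hd : 2 ≤ d) (γ : IrreducibleBridge hd) :
    ENNReal.ofReal ((connectiveConstant d)⁻¹ ^ γ.length) = irredWeight (toIrred hd γ) := by
  rw [irredWeight, walkWeight, length_toIrred, critWeight,
    ENNReal.ofReal_pow (inv_pos.2 (connectiveConstant_pos (by omega))).le]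

lemma isProbabilityMeasure_irreducibleBridgeLaw (hd : 2 ≤ d) :
    IsProbabilityMeasure (irreducibleBridgeLaw hd) := by
  refine ⟨?_⟩
  rw [irreducibleBridgeLaw, Measure.sum_apply _ MeasurableSet.univ]
  simp_rw [ofReal_inv_pow_length]
  have := (Equiv.ofBijective _ (toIrred_bijective hd)).tsum_eq irredWeight
  rw [tsum_irredWeight] at this
  simpa using this

lemma lintegral_length_irreducibleBridgeLaw (hd : 2 ≤ d) :
    ∫⁻ γ, (γ.length : ℝ≥0∞) ∂(irreducibleBridgeLaw hd) = meanLength (⟨1, hd⟩ : Fin d) := by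
  have h1 : meanLength (⟨1, hd⟩ : Fin d) = ∑' γ : IrreducibleBridge hd,
      irredWeight (toIrred hd γ) * (toIrred hd γ).steps.length :=
    ((Equiv.ofBijective _ (toIrred_bijective hd)).tsum_eq
      fun a => irredWeight a * (a.steps.length : ℝ≥0∞)).symm
  rw [h1, irreducibleBridgeLaw, lintegral_sum_measure]
  refine tsum_congr fun γ => ?_
  rw [lintegral_smul_measure, lintegral_dirac' _ fun _ _ => MeasurableSpace.measurableSet_top, ofReal_inv_pow_length,
    length_toIrred, smul_eq_mul]

end SelfAvoiding

theorem theorem2p5 (d : ℕ) (hd : 2 ≤ d) :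
    (0 < connectiveConstant d ∧ Tendsto (sawRoot d) atTop (𝓝 (connectiveConstant d))) ∧
      IsProbabilityMeasure (irreducibleBridgeLaw hd) ∧
      ∫⁻ γ, (γ.length : ℝ≥0∞) ∂(irreducibleBridgeLaw hd) = ⊤ := by
  refine ⟨⟨SelfAvoiding.connectiveConstant_pos (by omega),
    SelfAvoiding.tendsto_sawRoot (by omega)⟩,
    SelfAvoiding.isProbabilityMeasure_irreducibleBridgeLaw hd, ?_⟩
  rw [SelfAvoiding.lintegral_length_irreducibleBridgeLaw]
  exact SelfAvoiding.meanLength_eq_top (i := ⟨0, by omega⟩) (by simp)
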